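/- For a permutation $\pi$ write $\pi_i$ for its $i$-th entry in one-line notation. Let $\mathcal S_N$ be the set of permutations of $\{1,\dots,N\}$. A permutation $\sigma\in\mathcal S_N$ contains a pattern $\tau\in\mathcal S_k$ if there are $1\le i_1<\dots<i_k\le N$ such that $\sigma_{i_1},\dots,\sigma_{i_k}$ are in the same relative order as $\tau_1,\dots,\tau_k$; otherwise it avoids $\tau$. Let $\mathcal S_N(\tau)$ be the set of $\sigma\in\mathcal S_N$ that avoid $\tau$, and put $$L(\tau)=\lim_{N\to\infty}|\mathcal S_N(\tau)|^{1/N}.$$ For real $A>0$ put $\mathcal S_N^{*A}(\tau)=\{\sigma\in\mathcal S_N(\tau):\ \sigma_i>N-i-A\text{ for all }i=1,\dots,N\}$, and for $1\le I,J\le N$ put $\mathcal F_N(I,J;\tau)=\{\sigma\in\mathcal S_N(\tau):\ \sigma_I=J\}$. For $c>1$ put $$g(x,y;c)=\left(\frac{2cx+(y-x)-\sqrt{(y-x)^2+4cxy}}{x(c-1)}\right)^{-x}\qquad(x,y>0),$$ $$G(u,v;c)=4c\,g(u,v;c)\,g(v,u;c)\,g(1-u,1-v;c)\,g(1-v,1-u;c)\qquad(0<u,v<1).$$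 **Theorem.** Let $\hat\tau$ be a pattern of length $m\ge 3$ with $\hat\tau_1=1$, and assume that $$\lim_{N\to\infty}|\mathcal S_N^{*N\varepsilon}(\hat\tau)|^{1/N}=L(\hat\tau)\qquad\text{for every }\varepsilon>0 .$$ Let $\tau$ be the pattern $1\,(\hat\tau_1+1)(\hat\tau_2+1)\cdots(\hat\tau_m+1)$ of length $m+1$. Let $\gamma,\delta\in(0,1)$ with $\gamma<1-\delta$, and for each $N\ge 1$ let $I_N,J_N$ be integers in $[1,N]$ such that $I_N/N\to\gamma$ and $J_N/N\to\delta$ as $N\to\infty$. Then $$\lim_{N\to\infty}|\mathcal F_N(I_N,J_N;\tau)|^{1/N}=G\bigl(\gamma,1-\delta;L(\hat\tau)\bigr).$$ -/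

import Mathlib

open Filter Topology

namespace PatternLD

/-- The permutation `σ` contains the pattern `τ`: there are positions `f 0 < f 1 < ⋯` at which
the entries of `σ` are in the same relative order as the entries of `τ`. -/
def Contains {N k : ℕ} (σ : Equiv.Perm (Fin N)) (τ : Equiv.Perm (Fin k)) : Prop :=
  ∃ f : Fin k → Fin N, StrictMono f ∧ ∀ i j : Fin k, σ (f i) < σ (f j) ↔ τ i < τ j

/-- `𝒮_N(τ)`: the permutations of length `N` that avoid `τ`. -/
def avoiders (N : ℕ) {k : ℕ} (τ : Equiv.Perm (Fin k)) : Set (Equiv.Perm (Fin N)) :=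
  {σ | ¬ Contains σ τ}

/-- `𝒮_N^{*A}(τ)`: the `σ ∈ 𝒮_N(τ)` with `σ_i > N - i - A` for every `i`. Positions and values
are numbered from `1` here, hence the shifts by one. -/
def nearAvoiders (N : ℕ) (A : ℝ) {k : ℕ} (τ : Equiv.Perm (Fin k)) : Set (Equiv.Perm (Fin N)) :=
  {σ | σ ∈ avoiders N τ ∧
    ∀ i : Fin N, (N : ℝ) - (((i : ℕ) : ℝ) + 1) - A < ((σ i : ℕ) : ℝ) + 1}

/-- `ℱ_N(I, J; τ)`: the `σ ∈ 𝒮_N(τ)` with `σ_I = J`, where positions and values are numbered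
from `1`. -/
def avoidersThrough (N I J : ℕ) {k : ℕ} (τ : Equiv.Perm (Fin k)) : Set (Equiv.Perm (Fin N)) :=
  {σ | σ ∈ avoiders N τ ∧ ∃ i : Fin N, (i : ℕ) + 1 = I ∧ (σ i : ℕ) + 1 = J}

/-- `L(τ) = lim_N |𝒮_N(τ)|^{1/N}`. -/
noncomputable def growthRate {k : ℕ} (τ : Equiv.Perm (Fin k)) : ℝ :=
  limUnder atTop (fun N : ℕ => ((avoiders N τ).ncard : ℝ) ^ (1 / (N : ℝ)))

/-- `1 ⊘ ω = 1 (ω₁ + 1) (ω₂ + 1) ⋯ (ω_m + 1)`. -/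
def oneOslash {m : ℕ} (ω : Equiv.Perm (Fin m)) : Equiv.Perm (Fin (m + 1)) where
  toFun := Fin.cons 0 (fun i => (ω i).succ)
  invFun := Fin.cons 0 (fun i => (ω.symm i).succ)
  left_inv := fun i => by
    refine Fin.cases ?_ (fun j => ?_) i <;> simp
  right_inv := fun i => by
    refine Fin.cases ?_ (fun j => ?_) i <;> simp

/-- The function `g(x, y; c)`, used for `x, y > 0` and `c > 1`. -/
noncomputable def g (x y c : ℝ) : ℝ :=
  ((2 * c * x + (y - x) - Real.sqrt ((y - x) ^ 2 + 4 * c * x * y)) / (x * (c - 1))) ^ (-x)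

/-- The function `G(u, v; c)`, used for `0 < u, v < 1` and `c > 1`. -/
noncomputable def G (u v c : ℝ) : ℝ :=
  4 * c * g u v c * g v u c * g (1 - u) (1 - v) c * g (1 - v) (1 - u) c

end PatternLD

/-! Left-to-right minima decrease, so a permutation is determined by their positions `A`, their
values `B` and the pattern `ω` of the remaining entries. Let `τ` begin with its least entry. If the
permutation avoids `1 ⊘ τ`, then `ω` avoids `τ`: a minimum to the left of and below the first entry
of a copy of `τ` is to the left of and below the whole copy. Conversely, gluing a `τ`-avoider to
`(A, B)` yields a `(1 ⊘ τ)`-avoider, provided that the minima are still exactly `A`. Up to this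
proviso the count is a sum over pairs `(A, B)` of about `c ^ (N - |A|)`, where `c` is the growth
rate of `τ`.

Suppose a minimum sits at `(γN, δN)`, with `αN` minima to its left (hence above) and `βN` to its
right (hence below). The choices of `(A, B, ω)` then have exponent `ent γ α + ent (1-δ) α + ent
(1-γ) β + ent δ β + (1-α-β) log c`. It is critical when `c α² = (γ-α)(1-δ-α)` and `c β² =
(1-γ-β)(δ-β)`; at these roots (`crit`) it equals `log G` (`log_G_eq_ent`).

Upper bound (`ncard_avoidersThrough_le`): some minimum lies weakly to the left of and below `(I,
J)`, which leaves at most `N²` candidates. Each is counted with exponential weights, and since `γ <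
1 - δ` the resulting bound is worst at `(I, J)` itself.

Lower bound (`card_profileSets_mul_le`): `(I, J)` is made a minimum. The proviso is secured by
taking `ω` near or above the antidiagonal, putting about `ηN` extra minima at the left end and at
the bottom, and using sets with dense prefixes, which by the cycle lemma costs only a polynomial
factor. Letting `η → 0` recovers `log G`. -/

namespace PatternLD

/-! ### Left-to-right minima -/

/-- The positions of the left-to-right minima of a permutation. -/
def lrMin {N : ℕ} (σ : Equiv.Perm (Fin N)) : Finset (Fin N) :=
  Finset.univ.filter (fun i => ∀ j, j < i → σ i < σ j)

theorem mem_lrMin {N : ℕ} {σ : Equiv.Perm (Fin N)} {i : Fin N} :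
    i ∈ lrMin σ ↔ ∀ j, j < i → σ i < σ j := by
  simp [lrMin]

/-- Every entry lies weakly above and to the right of some left-to-right minimum. -/
theorem exists_lrMin_le {N : ℕ} (σ : Equiv.Perm (Fin N)) (x : Fin N) :
    ∃ y ∈ lrMin σ, y ≤ x ∧ σ y ≤ σ x := by
  obtain ⟨y, hy, hmin⟩ := Finset.exists_min_image (Finset.Iic x) σ ⟨x, by simp⟩
  refine ⟨y, mem_lrMin.2 fun j hj => ?_, Finset.mem_Iic.1 hy, hmin x (by simp)⟩
  exact lt_of_le_of_ne (hmin j (Finset.mem_Iic.2 (hj.le.trans (Finset.mem_Iic.1 hy))))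
    (fun h => hj.ne' (σ.injective h))

/-! ### Decomposition into minima and remaining pattern -/

/-- The permutation that maps `A` onto `B` decreasingly and `Aᶜ` onto `Bᶜ` with pattern `ω`. -/
def glue {N k n : ℕ} {A B : Finset (Fin N)} (hA : A.card = k) (hA' : Aᶜ.card = n)
    (hB : B.card = k) (hB' : Bᶜ.card = n) (ω : Equiv.Perm (Fin n)) : Equiv.Perm (Fin N) :=
  (finSumEquivOfFinset hA hA').symm.trans
    ((Equiv.sumCongr Fin.revPerm ω).trans (finSumEquivOfFinset hB hB'))

section glue

variable {N k n : ℕ} {A B : Finset (Fin N)} (hA : A.card = k) (hA' : Aᶜ.card = n)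
  (hB : B.card = k) (hB' : Bᶜ.card = n) (ω : Equiv.Perm (Fin n))

theorem glue_apply_mem (i : Fin k) :
    glue hA hA' hB hB' ω (A.orderEmbOfFin hA i) = B.orderEmbOfFin hB i.rev := by
  rw [← finSumEquivOfFinset_inl hA hA', ← finSumEquivOfFinset_inl hB hB']
  simp only [glue, Equiv.trans_apply, Equiv.symm_apply_apply]
  rfl

theorem glue_apply_compl (i : Fin n) :
    glue hA hA' hB hB' ω (Aᶜ.orderEmbOfFin hA' i) = Bᶜ.orderEmbOfFin hB' (ω i) := by
  rw [← finSumEquivOfFinset_inr hA hA', ← finSumEquivOfFinset_inr hB hB']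
  simp only [glue, Equiv.trans_apply, Equiv.symm_apply_apply]
  rfl

theorem exists_orderEmbOfFin_eq {m : ℕ} {S : Finset (Fin N)} (hS : S.card = m) {x : Fin N}
    (hx : x ∈ S) : ∃ i, S.orderEmbOfFin hS i = x := by
  have : x ∈ Set.range (S.orderEmbOfFin hS) := by simpa using hx
  exact this

theorem glue_mem_iff (x : Fin N) : glue hA hA' hB hB' ω x ∈ B ↔ x ∈ A := by
  by_cases hx : x ∈ A
  · obtain ⟨i, rfl⟩ := exists_orderEmbOfFin_eq hA hx
    simp [glue_apply_mem]
  · obtain ⟨i, rfl⟩ := exists_orderEmbOfFin_eq hA' (Finset.mem_compl.2 hx)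
    rw [glue_apply_compl]
    have := Finset.orderEmbOfFin_mem Bᶜ hB' (ω i)
    simp only [Finset.mem_compl] at this
    simp [hx, this]

theorem map_glue : A.map (glue hA hA' hB hB' ω).toEmbedding = B := by
  ext y
  obtain ⟨x, rfl⟩ := (glue hA hA' hB hB' ω).surjective y
  rw [glue_mem_iff]
  simp

theorem glue_lt_of_mem {x y : Fin N} (hx : x ∈ A) (hy : y ∈ A) (hxy : x < y) :
    glue hA hA' hB hB' ω y < glue hA hA' hB hB' ω x := by
  obtain ⟨i, rfl⟩ := exists_orderEmbOfFin_eq hA hx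
  obtain ⟨j, rfl⟩ := exists_orderEmbOfFin_eq hA hy
  rw [glue_apply_mem, glue_apply_mem]
  simpa using hxy

theorem glue_injective : Function.Injective (glue hA hA' hB hB') := by
  intro ω ω' h
  ext i : 1
  have := DFunLike.congr_fun h (Aᶜ.orderEmbOfFin hA' i)
  rw [glue_apply_compl, glue_apply_compl] at this
  exact (Bᶜ.orderEmbOfFin hB').injective this

/-- If every entry outside `A` dominates an entry in `A`, then `A` is the set of left-to-right
minima. -/
theorem lrMin_glue
    (hdom : ∀ x ∉ A, ∃ y ∈ A, y < x ∧ glue hA hA' hB hB' ω y < glue hA hA' hB hB' ω x) :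
    lrMin (glue hA hA' hB hB' ω) = A := by
  ext x
  rw [mem_lrMin]
  constructor
  · intro h
    by_contra hx
    obtain ⟨y, -, hyx, hlt⟩ := hdom x hx
    exact lt_asymm hlt (h y hyx)
  · intro hx j hj
    by_cases hjA : j ∈ A
    · exact glue_lt_of_mem hA hA' hB hB' ω hjA hx hj
    · obtain ⟨y, hy, hyj, hlt⟩ := hdom j hjA
      exact (glue_lt_of_mem hA hA' hB hB' ω hy hx (hyj.trans hj)).trans hlt

/-- The minima decrease, which forces the bijection from `A` to `B`; only the pattern on the
complement is free. -/
theorem exists_eq_glue {σ : Equiv.Perm (Fin N)} (hσ : lrMin σ = A)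
    (hσB : A.map σ.toEmbedding = B) : ∃ ω, σ = glue hA hA' hB hB' ω := by
  have hmem : ∀ x, σ x ∈ B ↔ x ∈ A := by
    intro x; rw [← hσB]; simp
  let e : Equiv.Perm (Fin k ⊕ Fin n) :=
    (finSumEquivOfFinset hA hA').trans (σ.trans (finSumEquivOfFinset hB hB').symm)
  have he : ∀ i : Fin k, ∃ j : Fin k, σ (A.orderEmbOfFin hA i) = B.orderEmbOfFin hB j := by
    intro i
    obtain ⟨j, hj⟩ := exists_orderEmbOfFin_eq hB
      ((hmem _).2 (Finset.orderEmbOfFin_mem A hA i))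
    exact ⟨j, hj.symm⟩
  have hmaps : Set.MapsTo e (Set.range Sum.inl) (Set.range Sum.inl) := by
    rintro _ ⟨i, rfl⟩
    obtain ⟨j, hj⟩ := he i
    refine ⟨j, ?_⟩
    simp only [e, Equiv.trans_apply, finSumEquivOfFinset_inl, hj]
    rw [Equiv.eq_symm_apply, finSumEquivOfFinset_inl]
  obtain ⟨⟨ρ, ω⟩, hρ⟩ := Equiv.Perm.mem_sumCongrHom_range_of_perm_mapsTo_inl hmaps
  have hρ' : ∀ x, finSumEquivOfFinset hB hB' (Equiv.sumCongr ρ ω x)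
      = σ (finSumEquivOfFinset hA hA' x) := by
    intro x
    have := DFunLike.congr_fun hρ x
    simp only [Equiv.Perm.sumCongrHom_apply, e, Equiv.trans_apply] at this
    rw [Equiv.eq_symm_apply] at this
    exact this
  have hanti : StrictAnti ρ := by
    intro i j hij
    have h1 := hρ' (Sum.inl i)
    have h2 := hρ' (Sum.inl j)
    simp only [Equiv.sumCongr_apply, Sum.map_inl, finSumEquivOfFinset_inl] at h1 h2
    have hj : A.orderEmbOfFin hA j ∈ lrMin σ := by rw [hσ]; simp
    have := mem_lrMin.1 hj (A.orderEmbOfFin hA i) (by simpa using hij)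
    rw [← h1, ← h2] at this
    simpa using this
  have hrev : ρ = Fin.revPerm := by
    -- Reversing `ρ` gives an increasing surjection of `Fin k`, which can only be the identity.
    have hm : StrictMono (fun i => (ρ i).rev) := fun i j hij => by
      simpa using hanti hij
    have hid : (fun i => (ρ i).rev) = id := by
      refine ((hm.range_inj strictMono_id).1 ?_)
      rw [Set.range_id]
      exact (Fin.rev_surjective.comp ρ.surjective).range_eq
    ext i : 1
    have := congrFun hid i
    simp only [id] at this
    rw [Fin.revPerm_apply, ← this, Fin.rev_rev, this]
  refine ⟨ω, ?_⟩
  ext x : 1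
  obtain ⟨z, rfl⟩ := (finSumEquivOfFinset hA hA').surjective x
  rw [← hρ' z, hrev]
  simp [glue]

end glue

/-! ### Avoidance of `1 ⊘ τ` in terms of the remaining pattern -/

theorem oneOslash_lt_iff {m : ℕ} (ω : Equiv.Perm (Fin m)) (i j : Fin m) :
    oneOslash ω i.succ < oneOslash ω j.succ ↔ ω i < ω j := by
  simp [oneOslash]

theorem oneOslash_zero {m : ℕ} (ω : Equiv.Perm (Fin m)) : oneOslash ω 0 = 0 := rfl

theorem oneOslash_pos {m : ℕ} (ω : Equiv.Perm (Fin m)) (i : Fin m) :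
    0 < oneOslash ω i.succ := by
  simp [oneOslash]

/-- Prepending a lower entry to a copy of `τ` gives a copy of `1 ⊘ τ`. -/
theorem contains_oneOslash {N m : ℕ} {σ : Equiv.Perm (Fin N)} {τ : Equiv.Perm (Fin m)}
    (f : Fin m → Fin N) (hf : StrictMono f) (hτ : ∀ i j, σ (f i) < σ (f j) ↔ τ i < τ j)
    (x : Fin N) (hx : ∀ i, x < f i) (hσx : ∀ i, σ x < σ (f i)) :
    Contains σ (oneOslash τ) := by
  refine ⟨Fin.cons x f, ?_, ?_⟩
  · intro i j hij
    induction i using Fin.cases with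
    | zero =>
      induction j using Fin.cases with
      | zero => exact absurd hij (lt_irrefl _)
      | succ j => simpa using hx j
    | succ i =>
      induction j using Fin.cases with
      | zero => exact absurd hij (Fin.not_lt_zero _)
      | succ j => simpa using hf (Fin.succ_lt_succ_iff.1 hij)
  · intro i j
    induction i using Fin.cases with
    | zero =>
      induction j using Fin.cases with
      | zero => simp
      | succ j => simpa [oneOslash_zero, oneOslash_pos] using hσx j
    | succ i =>
      induction j using Fin.cases with
      | zero => simpa [oneOslash_zero] using (hσx i).le
      | succ j => simpa [oneOslash_lt_iff] using hτ i j

section avoid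

variable {N k n m : ℕ} {A B : Finset (Fin N)} (hA : A.card = k) (hA' : Aᶜ.card = n)
  (hB : B.card = k) (hB' : Bᶜ.card = n) (ω : Equiv.Perm (Fin n))

theorem glue_compl_lt_iff (i j : Fin n) :
    glue hA hA' hB hB' ω (Aᶜ.orderEmbOfFin hA' i) < glue hA hA' hB hB' ω (Aᶜ.orderEmbOfFin hA' j)
      ↔ ω i < ω j := by
  simp [glue_apply_compl]

/-- The index `i₀` is both leftmost and lowest in `τ`, so a minimum to the left of and below the
entry playing `i₀` extends the whole copy of `τ` to a copy of `1 ⊘ τ`. -/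
theorem avoids_of_glue_avoids {τ : Equiv.Perm (Fin m)} (i₀ : Fin m) (hi₀ : ∀ i, i₀ ≤ i)
    (hτ₀ : ∀ i, τ i₀ ≤ τ i) (hmin : lrMin (glue hA hA' hB hB' ω) = A)
    (h : glue hA hA' hB hB' ω ∈ avoiders N (oneOslash τ)) : ω ∈ avoiders n τ := by
  rintro ⟨f, hf, hfτ⟩
  apply h
  have h0 : Aᶜ.orderEmbOfFin hA' (f i₀) ∉ lrMin (glue hA hA' hB hB' ω) := by
    rw [hmin]
    exact Finset.mem_compl.1 (Finset.orderEmbOfFin_mem _ hA' _)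
  obtain ⟨y, hy, hyx, hlt⟩ := exists_lrMin_le (glue hA hA' hB hB' ω) (Aᶜ.orderEmbOfFin hA' (f i₀))
  have hne : y ≠ Aᶜ.orderEmbOfFin hA' (f i₀) := fun h => h0 (h ▸ hy)
  refine contains_oneOslash (fun i => Aᶜ.orderEmbOfFin hA' (f i))
    (fun i j hij => by simpa using hf hij)
    (fun i j => by rw [glue_compl_lt_iff]; exact hfτ i j) y (fun i => ?_) (fun i => ?_)
  · exact (lt_of_le_of_ne hyx hne).trans_le (by simpa using hf.monotone (hi₀ i))
  · refine (lt_of_le_of_ne hlt fun h => hne ((glue hA hA' hB hB' ω).injective h)).trans_le ?_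
    refine le_of_not_gt fun hh => ?_
    rw [glue_compl_lt_iff, hfτ] at hh
    exact absurd (hτ₀ i) (not_le.2 hh)

/-- In a copy of `1 ⊘ τ` every entry after the first has a smaller one to its left, so it is not a
minimum; the copy of `τ` therefore lives in `ω`. -/
theorem glue_avoids {τ : Equiv.Perm (Fin m)} (hmin : lrMin (glue hA hA' hB hB' ω) = A)
    (h : ω ∈ avoiders n τ) : glue hA hA' hB hB' ω ∈ avoiders N (oneOslash τ) := by
  rintro ⟨f, hf, hfτ⟩
  apply h
  have hmem : ∀ i : Fin m, f i.succ ∈ Aᶜ := by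
    intro i
    rw [Finset.mem_compl, ← hmin, mem_lrMin]
    intro hh
    refine lt_asymm (hh (f 0) (hf (Fin.succ_pos i))) ?_
    rw [hfτ]
    exact oneOslash_pos τ i
  choose e he using fun i => exists_orderEmbOfFin_eq hA' (hmem i)
  refine ⟨e, fun i j hij => ?_, fun i j => ?_⟩
  · have := hf (Fin.succ_lt_succ_iff.2 hij)
    rw [← he, ← he] at this
    simpa using this
  · rw [← glue_compl_lt_iff hA hA' hB hB' ω, he, he, hfτ, oneOslash_lt_iff]

end avoid

/-- The permutations with left-to-right minima at the positions `A`, taking the values `B`. -/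
def minClass {N : ℕ} (A B : Finset (Fin N)) : Set (Equiv.Perm (Fin N)) :=
  {σ | lrMin σ = A ∧ A.map σ.toEmbedding = B}

theorem card_compl_fin {N : ℕ} (A : Finset (Fin N)) : Aᶜ.card = N - A.card := by
  simp [Finset.card_compl]

theorem ncard_avoiders_inter_minClass_le {N m : ℕ} {τ : Equiv.Perm (Fin m)} (i₀ : Fin m)
    (hi₀ : ∀ i, i₀ ≤ i) (hτ₀ : ∀ i, τ i₀ ≤ τ i) (A B : Finset (Fin N)) :
    (avoiders N (oneOslash τ) ∩ minClass A B).ncard ≤ (avoiders (N - A.card) τ).ncard := by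
  by_cases hAB : B.card = A.card
  · have hB' : Bᶜ.card = N - A.card := by rw [card_compl_fin, hAB]
    refine (Set.ncard_le_ncard (t := glue rfl (card_compl_fin A) hAB hB' ''
      avoiders (N - A.card) τ) ?_ (Set.toFinite _)).trans (Set.ncard_image_le (Set.toFinite _))
    rintro σ ⟨hσ, hσA, hσB⟩
    obtain ⟨ω, rfl⟩ := exists_eq_glue rfl (card_compl_fin A) hAB hB' hσA hσB
    exact ⟨ω, avoids_of_glue_avoids _ _ _ _ ω i₀ hi₀ hτ₀ hσA hσ, rfl⟩
  · have : avoiders N (oneOslash τ) ∩ minClass A B = ∅ := by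
      refine Set.eq_empty_of_forall_notMem ?_
      rintro σ ⟨-, -, rfl⟩
      simp at hAB
    simp [this]

theorem ncard_eq_sum_fiber {α β : Type*} [Fintype α] [Fintype β] (f : α → β) (S : Set α) :
    S.ncard = ∑ b, (S ∩ {x | f x = b}).ncard := by
  classical
  rw [Set.ncard_eq_toFinset_card']
  rw [Finset.card_eq_sum_card_fiberwise (f := f) (t := Finset.univ) (fun _ _ => by simp)]
  refine Finset.sum_congr rfl fun b _ => ?_
  rw [Set.ncard_eq_toFinset_card']
  congr 1
  ext x
  simp

/-- A set of permutations is partitioned by the positions and values of left-to-right minima. -/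
theorem ncard_eq_sum_minClass {N : ℕ} (S : Set (Equiv.Perm (Fin N))) :
    S.ncard = ∑ AB : Finset (Fin N) × Finset (Fin N), (S ∩ minClass AB.1 AB.2).ncard := by
  rw [ncard_eq_sum_fiber (fun σ => (lrMin σ, (lrMin σ).map σ.toEmbedding)) S]
  refine Finset.sum_congr rfl fun AB _ => ?_
  congr 2
  ext σ
  constructor
  · rintro rfl
    exact ⟨rfl, rfl⟩
  · rintro ⟨h1, h2⟩
    ext : 1
    · exact h1
    · simp only [h1, h2]

/-! ### The cycle lemma for sets with dense prefixes -/

section cycle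

/-- The `a`-subsets of `{0, …, l - 1}` all of whose prefixes are at least as dense as the
whole. -/
def denseSets (l a : ℕ) : Finset (Finset ℕ) :=
  (Finset.powersetCard a (Finset.range l)).filter
    (fun S => ∀ r ≤ l, r * a ≤ l * Nat.count (· ∈ S) r)

theorem count_congr {p q : ℕ → Prop} [DecidablePred p] [DecidablePred q] {m : ℕ}
    (h : ∀ i < m, p i ↔ q i) : Nat.count p m = Nat.count q m := by
  rw [Nat.count_eq_card_filter_range, Nat.count_eq_card_filter_range]
  congr 1
  exact Finset.filter_congr fun i hi => h i (Finset.mem_range.1 hi)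

theorem count_mem_of_subset {S : Finset ℕ} {l : ℕ} (hS : S ⊆ Finset.range l) :
    Nat.count (· ∈ S) l = S.card := by
  rw [Nat.count_eq_card_filter_range]
  congr 1
  ext i
  simp only [Finset.mem_filter]
  exact ⟨fun h => h.2, fun h => ⟨hS h, h⟩⟩

/-- Start the cycle where the discrepancy `l * P r - r * a` of the prefix counts is least; from
there no prefix can fall below the average density. -/
theorem exists_rotate_dense {l a : ℕ} (hl : 0 < l) {S : Finset ℕ}
    (hS : S ∈ Finset.powersetCard a (Finset.range l)) :
    ∃ r < l, (Finset.range l).filter (fun i => (r + i) % l ∈ S) ∈ denseSets l a := by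
  obtain ⟨hSl, hSa⟩ := Finset.mem_powersetCard.1 hS
  set f : ℕ → Prop := fun i => i % l ∈ S with hf
  set P : ℕ → ℕ := fun r => Nat.count f r with hP
  have hPl : P l = a := by
    rw [← hSa, ← count_mem_of_subset hSl]
    exact count_congr fun i hi => by simp [hf, Nat.mod_eq_of_lt hi]
  have hper : ∀ r, P (l + r) = a + P r := by
    intro r
    rw [← hPl]
    simp only [hP]
    rw [Nat.count_add]
    congr 1
    exact count_congr fun i _ => by simp [hf]
  obtain ⟨r, hr, hmin⟩ := Finset.exists_min_image (Finset.range l)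
    (fun r => (l : ℤ) * P r - r * a) ⟨0, by simpa using hl⟩
  rw [Finset.mem_range] at hr
  -- The discrepancy has period `l`, so the minimum over one period also serves the next.
  have hmin' : ∀ m < 2 * l, (l : ℤ) * P r - r * a ≤ l * P m - m * a := by
    intro m hm
    by_cases hml : m < l
    · exact hmin m (Finset.mem_range.2 hml)
    · obtain ⟨d, rfl⟩ := Nat.exists_eq_add_of_le (not_lt.1 hml)
      have := hmin d (Finset.mem_range.2 (by omega))
      rw [hper]
      push_cast
      linarith
  have hcount : ∀ x ≤ l, P (r + x)
      = P r + Nat.count (· ∈ (Finset.range l).filter (fun i => (r + i) % l ∈ S)) x := by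
    intro x hx
    simp only [hP]
    rw [Nat.count_add]
    congr 1
    refine count_congr fun i hi => ?_
    simp only [hf, Finset.mem_filter, Finset.mem_range]
    exact ⟨fun h => ⟨by omega, h⟩, fun h => h.2⟩
  refine ⟨r, hr, Finset.mem_filter.2 ⟨Finset.mem_powersetCard.2
    ⟨Finset.filter_subset _ _, ?_⟩, ?_⟩⟩
  · rw [← count_mem_of_subset (Finset.filter_subset _ _)]
    have := hcount l le_rfl
    rw [add_comm r l, hper] at this
    omega
  · intro x hx
    have h1 := hmin' (r + x) (by omega)
    rw [hcount x hx] at h1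
    push_cast at h1
    zify
    linarith

/-- The cycle lemma: at least a proportion `1 / l` of the sets are dense. -/
theorem choose_le_card_denseSets {l : ℕ} (hl : 0 < l) (a : ℕ) :
    l.choose a ≤ l * (denseSets l a).card := by
  -- Rotating back recovers `S`, so every `a`-subset is one of the `l` rotations of a dense set.
  have hsub : Finset.powersetCard a (Finset.range l) ⊆
      (Finset.range l ×ˢ denseSets l a).image
        (fun q => (Finset.range l).filter (fun i => (i + (l - q.1)) % l ∈ q.2)) := by
    intro S hS
    obtain ⟨r, hr, hd⟩ := exists_rotate_dense hl hS
    refine Finset.mem_image.2 ⟨(r, (Finset.range l).filter (fun i => (r + i) % l ∈ S)),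
      Finset.mem_product.2 ⟨Finset.mem_range.2 hr, hd⟩, ?_⟩
    ext i
    rw [Finset.mem_filter, Finset.mem_filter, Finset.mem_range, Finset.mem_range,
      Nat.add_mod_mod]
    have hSl := (Finset.mem_powersetCard.1 hS).1
    constructor
    · rintro ⟨hi, -, h⟩
      rwa [show r + (i + (l - r)) = i + l by omega, Nat.add_mod_right, Nat.mod_eq_of_lt hi] at h
    · intro h
      have hi := Finset.mem_range.1 (hSl h)
      refine ⟨hi, Nat.mod_lt _ hl, ?_⟩
      rwa [show r + (i + (l - r)) = i + l by omega, Nat.add_mod_right, Nat.mod_eq_of_lt hi]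
  calc l.choose a = (Finset.powersetCard a (Finset.range l)).card := by simp
    _ ≤ _ := Finset.card_le_card hsub
    _ ≤ _ := Finset.card_image_le
    _ = _ := by simp

end cycle

/-! ### Words with a full initial block, two dense pieces and a marked point -/

section word

/-- The set consisting of `{0, …, s - 1}`, a shifted copy of `S`, the point `s + l`, and a
shifted copy of `T`. -/
def wordSet (s l : ℕ) (S T : Finset ℕ) : ℕ → Prop := fun x =>
  x < s ∨ (s ≤ x ∧ x < s + l ∧ x - s ∈ S) ∨ x = s + l ∨ (s + l < x ∧ x - (s + l + 1) ∈ T)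

instance (s l : ℕ) (S T : Finset ℕ) : DecidablePred (wordSet s l S T) := fun _ => by
  unfold wordSet; infer_instance

variable {s l : ℕ} {S T : Finset ℕ}

theorem count_wordSet_prefix {y : ℕ} (hy : y ≤ l) :
    Nat.count (wordSet s l S T) (s + y) = s + Nat.count (· ∈ S) y := by
  rw [Nat.count_add]
  congr 1
  · rw [Nat.count_iff_forall.2]
    intro i hi
    exact Or.inl hi
  · refine count_congr fun i hi => ?_
    unfold wordSet
    constructor
    · rintro (h | h | h | h)
      · omega
      · simpa using h.2.2
      · omega
      · omega
    · intro h
      exact Or.inr (Or.inl ⟨by omega, by omega, by simpa using h⟩)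

theorem count_wordSet_suffix (y : ℕ) :
    Nat.count (wordSet s l S T) (s + l + 1 + y)
      = s + Nat.count (· ∈ S) l + 1 + Nat.count (· ∈ T) y := by
  rw [Nat.count_add, Nat.count_succ, count_wordSet_prefix le_rfl,
    if_pos (show wordSet s l S T (s + l) from Or.inr (Or.inr (Or.inl rfl)))]
  congr 1
  refine count_congr fun i hi => ?_
  unfold wordSet
  constructor
  · rintro (h | h | h | h)
    · omega
    · omega
    · omega
    · simpa using h.2
  · intro h
    exact Or.inr (Or.inr (Or.inr ⟨by omega, by simpa using h⟩))

/-- Plot elements against nonelements. Density of the pieces keeps the profile above a broken line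
that starts at height `s` with slopes `a / n₁` and then `b / n₂`. By `hab` this line is concave, so
it lies above its chord of slope `(a + b) / (n₁ + n₂)`. The contribution of the marked point is
discarded. -/
theorem wordSet_profile {l₂ a b n₁ n₂ : ℕ} (hn₁ : 0 < n₁) (hn₂ : 0 < n₂)
    (hl : l = a + n₁) (hl₂ : l₂ = b + n₂) (hab : b * n₁ ≤ a * n₂)
    (hS : S ∈ denseSets l a) (hT : T ∈ denseSets l₂ b) {x : ℕ} (hx : x < s + l + 1 + l₂)
    (hxW : ¬ wordSet s l S T x) :
    (n₁ + n₂) * s + (a + b) * (x - Nat.count (wordSet s l S T) x)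
      ≤ (n₁ + n₂) * Nat.count (wordSet s l S T) x := by
  obtain ⟨hS1, hS2⟩ := Finset.mem_filter.1 hS
  obtain ⟨hT1, hT2⟩ := Finset.mem_filter.1 hT
  obtain ⟨hSl, hSa⟩ := Finset.mem_powersetCard.1 hS1
  obtain ⟨hTl, hTb⟩ := Finset.mem_powersetCard.1 hT1
  have hxs : s ≤ x := not_lt.1 fun h => hxW (Or.inl h)
  have hxl : x ≠ s + l := fun h => hxW (Or.inr (Or.inr (Or.inl h)))
  rcases lt_or_gt_of_ne hxl with h | h
  · obtain ⟨y, rfl⟩ := Nat.exists_eq_add_of_le hxs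
    rw [count_wordSet_prefix (by omega)]
    have h1 := hS2 y (by omega)
    obtain ⟨f, hf⟩ := Nat.exists_eq_add_of_le (Nat.count_le (p := (· ∈ S)) (n := y))
    set t := Nat.count (· ∈ S) y
    rw [show s + y - (s + t) = f by omega]
    have h2 : f * a ≤ n₁ * t := by
      rw [hf, hl] at h1
      nlinarith
    have h3 : n₁ * ((a + b) * f) ≤ n₁ * ((n₁ + n₂) * t) := by
      calc n₁ * ((a + b) * f) = a * n₁ * f + b * n₁ * f := by ring
        _ ≤ a * n₁ * f + a * n₂ * f := by gcongr
        _ = (n₁ + n₂) * (f * a) := by ring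
        _ ≤ (n₁ + n₂) * (n₁ * t) := by gcongr
        _ = _ := by ring
    have h4 := Nat.le_of_mul_le_mul_left h3 hn₁
    linarith
  · obtain ⟨y, rfl⟩ := Nat.exists_eq_add_of_le (show s + l + 1 ≤ x by omega)
    rw [count_wordSet_suffix, count_mem_of_subset hSl, hSa]
    have h1 := hT2 y (by omega)
    obtain ⟨f, hf⟩ := Nat.exists_eq_add_of_le (Nat.count_le (p := (· ∈ T)) (n := y))
    obtain ⟨z, hz⟩ := Nat.exists_eq_add_of_le (show y ≤ l₂ by omega)
    have htot := count_mem_of_subset hTl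
    rw [hTb, hz, Nat.count_add] at htot
    have hle : Nat.count (fun k => y + k ∈ T) z ≤ z := Nat.count_le _
    set t := Nat.count (· ∈ T) y
    rw [show s + l + 1 + y - (s + a + 1 + t) = n₁ + f by omega]
    have hfn : f ≤ n₂ := by omega
    have h2 : f * b ≤ n₂ * t := by
      rw [hf, hl₂] at h1
      nlinarith
    obtain ⟨e, he⟩ := Nat.exists_eq_add_of_le hab
    have h3 : n₂ * ((a + b) * (n₁ + f)) ≤ n₂ * ((n₁ + n₂) * (a + t)) := by
      have h5 : e * f ≤ e * n₂ := by gcongr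
      have h6 : (n₁ + n₂) * (f * b) ≤ (n₁ + n₂) * (n₂ * t) := by gcongr
      have h7 : f * (a * n₂) = f * (b * n₁ + e) := by rw [he]
      have h8 : n₂ * (a * n₂) = n₂ * (b * n₁ + e) := by rw [he]
      nlinarith
    have h4 := Nat.le_of_mul_le_mul_left h3 hn₂
    nlinarith

end word

/-! ### Lower bound: gluing two profiles -/

section profile

/-- The number of elements of `A` below `x`. -/
def below {N : ℕ} (A : Finset (Fin N)) (x : Fin N) : ℕ := (A.filter (· < x)).card

/-- The `K`-subsets of `Fin N` that contain `p` with `t` elements below it, and for which the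
number of elements below a nonelement is bounded below by an affine function of the number of
nonelements below it. -/
def profileSets (N : ℕ) (p : Fin N) (t K s n m : ℕ) : Finset (Finset (Fin N)) :=
  Finset.univ.filter (fun A => A.card = K ∧ p ∈ A ∧ below A p = t ∧
    ∀ x ∉ A, n * s + m * (x - below A x) ≤ n * below A x)

theorem card_filter_fin (p : ℕ → Prop) [DecidablePred p] (N x : ℕ) (hx : x ≤ N) :
    (Finset.univ.filter (fun i : Fin N => p i ∧ (i : ℕ) < x)).card = Nat.count p x := by
  rw [Nat.count_eq_card_filter_range, ← Finset.card_map Fin.valEmbedding]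
  congr 1
  ext i
  simp only [Finset.mem_map, Finset.mem_filter, Finset.mem_univ, true_and, Finset.mem_range,
    Fin.valEmbedding_apply]
  constructor
  · rintro ⟨j, ⟨h1, h2⟩, rfl⟩
    exact ⟨h2, h1⟩
  · rintro ⟨h1, h2⟩
    exact ⟨⟨i, by omega⟩, ⟨h2, h1⟩, rfl⟩

theorem below_filter (p : ℕ → Prop) [DecidablePred p] {N : ℕ} (x : Fin N) :
    below (Finset.univ.filter (fun i : Fin N => p i)) x = Nat.count p x := by
  rw [← card_filter_fin p N x x.2.le, below, Finset.filter_filter]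
  rfl

theorem card_mul_card_le_profileSets {N s l l₂ a b n₁ n₂ : ℕ} (hn₁ : 0 < n₁) (hn₂ : 0 < n₂)
    (hl : l = a + n₁) (hl₂ : l₂ = b + n₂) (hab : b * n₁ ≤ a * n₂) (hN : N = s + l + 1 + l₂)
    (p : Fin N) (hp : (p : ℕ) = s + l) :
    (denseSets l a).card * (denseSets l₂ b).card
      ≤ (profileSets N p (s + a) (s + a + 1 + b) s (n₁ + n₂) (a + b)).card := by
  rw [← Finset.card_product]
  have hsub : ∀ q ∈ denseSets l a ×ˢ denseSets l₂ b,
      q.1 ⊆ Finset.range l ∧ q.1.card = a ∧ q.2 ⊆ Finset.range l₂ ∧ q.2.card = b := by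
    intro q hq
    obtain ⟨h1, h2⟩ := Finset.mem_product.1 hq
    obtain ⟨h3, h4⟩ := Finset.mem_powersetCard.1 (Finset.mem_filter.1 h1).1
    obtain ⟨h5, h6⟩ := Finset.mem_powersetCard.1 (Finset.mem_filter.1 h2).1
    exact ⟨h3, h4, h5, h6⟩
  refine Finset.card_le_card_of_injOn
    (fun q => Finset.univ.filter (fun i : Fin N => wordSet s l q.1 q.2 i)) ?_ ?_
  · intro q hq
    obtain ⟨h1, h2, h3, h4⟩ := hsub q hq
    refine Finset.mem_filter.2 ⟨Finset.mem_univ _, ?_, ?_, ?_, ?_⟩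
    · have := card_filter_fin (wordSet s l q.1 q.2) N N le_rfl
      simp only [Fin.is_lt, and_true] at this
      rw [this]
      conv_lhs => rw [hN]
      rw [count_wordSet_suffix, count_mem_of_subset h1, count_mem_of_subset h3, h2, h4]
    · simp only [Finset.mem_filter, Finset.mem_univ, true_and, hp]
      exact Or.inr (Or.inr (Or.inl rfl))
    · rw [below_filter, hp, count_wordSet_prefix le_rfl, count_mem_of_subset h1, h2]
    · intro x hx
      rw [below_filter]
      obtain ⟨h5, h6⟩ := Finset.mem_product.1 hq
      refine wordSet_profile hn₁ hn₂ hl hl₂ hab h5 h6 (by have := x.2; omega) ?_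
      simpa using hx
  · intro q hq q' hq' h
    obtain ⟨h1, h2, h3, h4⟩ := hsub q hq
    obtain ⟨h1', h2', h3', h4'⟩ := hsub q' hq'
    have key : ∀ x < N, wordSet s l q.1 q.2 x ↔ wordSet s l q'.1 q'.2 x := by
      intro x hx
      have := Finset.ext_iff.1 h ⟨x, hx⟩
      simpa using this
    have hmem₁ : ∀ i < l, i ∈ q.1 ↔ i ∈ q'.1 := by
      intro i hi
      have := key (s + i) (by omega)
      unfold wordSet at this
      have e1 : ¬ (s + i < s) := by omega
      have e2 : s + i ≠ s + l := by omega
      have e3 : ¬ (s + l < s + i) := by omega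
      simpa [e1, e2, e3, hi, hi.ne, hi.le] using this
    have hmem₂ : ∀ i < l₂, i ∈ q.2 ↔ i ∈ q'.2 := by
      intro i hi
      have := key (s + l + 1 + i) (by omega)
      unfold wordSet at this
      have e1 : ¬ (s + l + 1 + i < s) := by omega
      have e2 : s + l + 1 + i ≠ s + l := by omega
      have e3 : s + l < s + l + 1 + i := by omega
      have e4 : ¬ (s + l + 1 + i < s + l) := by omega
      simpa only [e1, e2, e3, e4, false_or, false_and, and_false, true_and,
        Nat.add_sub_cancel_left] using this
    ext i
    · by_cases hi : i < l
      · exact hmem₁ i hi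
      · exact iff_of_false (fun h => hi (Finset.mem_range.1 (h1 h)))
          (fun h => hi (Finset.mem_range.1 (h1' h)))
    · by_cases hi : i < l₂
      · exact hmem₂ i hi
      · exact iff_of_false (fun h => hi (Finset.mem_range.1 (h3 h)))
          (fun h => hi (Finset.mem_range.1 (h3' h)))

theorem below_orderEmbOfFin {N k : ℕ} {A : Finset (Fin N)} (hA : A.card = k) (i : Fin k) :
    below A (A.orderEmbOfFin hA i) = i := by
  rw [below, ← Fin.card_Iio i, ← Finset.card_map (A.orderEmbOfFin hA).toEmbedding]
  congr 1
  ext x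
  simp only [Finset.mem_filter, Finset.mem_map, Finset.mem_Iio, RelEmbedding.coe_toEmbedding]
  constructor
  · rintro ⟨hx, hlt⟩
    obtain ⟨j, rfl⟩ := exists_orderEmbOfFin_eq hA hx
    exact ⟨j, by simpa using hlt, rfl⟩
  · rintro ⟨j, hj, rfl⟩
    exact ⟨by simp, by simpa using hj⟩

theorem below_add_below_compl {N : ℕ} (A : Finset (Fin N)) (x : Fin N) :
    below A x + below Aᶜ x = x := by
  unfold below
  rw [← Finset.card_union_of_disjoint, ← Finset.filter_union, Finset.union_compl]
  · rw [← Fin.card_Iio x]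
    congr 1
    ext y
    simp
  · exact Finset.disjoint_filter_filter disjoint_compl_right

/-- Gluing the set systems of two profiles along a permutation near or above the antidiagonal. -/
theorem glue_dominates {N K s n m t t' : ℕ} {p p' : Fin N} {A B : Finset (Fin N)} {ε : ℝ}
    (hK : K = m + s + 1) (hm : 0 < m)
    (hs : (n : ℝ) + 2 * m + m * (n * ε) ≤ n * s)
    (hA : A ∈ profileSets N p t K s n m) (hB : B ∈ profileSets N p' t' K s n m)
    (hcA : A.card = K) (hcA' : Aᶜ.card = n) (hcB : B.card = K) (hcB' : Bᶜ.card = n)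
    {ω : Equiv.Perm (Fin n)}
    (hω : ∀ i : Fin n, (n : ℝ) - (((i : ℕ) : ℝ) + 1) - n * ε < ((ω i : ℕ) : ℝ) + 1)
    (x : Fin N) (hx : x ∉ A) :
    ∃ y ∈ A, y < x ∧ glue hcA hcA' hcB hcB' ω y < glue hcA hcA' hcB hcB' ω x := by
  obtain ⟨-, -, -, -, hA4⟩ := Finset.mem_filter.1 hA
  obtain ⟨-, -, -, -, hB4⟩ := Finset.mem_filter.1 hB
  set σ := glue hcA hcA' hcB hcB' ω with hσ
  have hy : σ x ∉ B := by rwa [hσ, glue_mem_iff]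
  have h1 := hA4 x hx
  have h2 := hB4 (σ x) hy
  obtain ⟨i, hi⟩ := exists_orderEmbOfFin_eq hcA' (Finset.mem_compl.2 hx)
  have hix : (x : ℕ) - below A x = i := by
    have := below_add_below_compl A x
    have h3 := below_orderEmbOfFin hcA' i
    rw [hi] at h3
    omega
  have hiy : (σ x : ℕ) - below B (σ x) = ω i := by
    have := below_add_below_compl B (σ x)
    have h3 := below_orderEmbOfFin hcB' (ω i)
    rw [← glue_apply_compl hcA hcA' hcB hcB' ω, hi, ← hσ] at h3
    omega
  rw [hix] at h1
  rw [hiy] at h2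
  have hn : 0 < n := i.pos
  -- The two profile bounds add up to at least `2 s + (m / n) (i + ω i)`, and `hω` makes `i + ω i`
  -- exceed `n - 2 - n ε`. Hypothesis `hs` says that this suffices to pass `K = m + s + 1`.
  have hbig : K < below A x + below B (σ x) := by
    have h3 := hω i
    have h4 : (m : ℝ) * (n - (((i : ℕ) : ℝ) + 1) - n * ε) < m * (((ω i : ℕ) : ℝ) + 1) := by
      have : (0 : ℝ) < m := by exact_mod_cast hm
      gcongr
    have h5 : (n : ℝ) * s + m * (i : ℕ) ≤ n * below A x := by exact_mod_cast h1
    have h6 : (n : ℝ) * s + m * (ω i : ℕ) ≤ n * below B (σ x) := by exact_mod_cast h2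
    have h7 : (n : ℝ) * K < n * (below A x + below B (σ x) : ℕ) := by
      rw [hK]; push_cast; nlinarith
    have h8 := lt_of_mul_lt_mul_left h7 (by positivity)
    exact_mod_cast h8
  have hcard : (A.filter (fun z => σ z < σ x)).card = below B (σ x) := by
    rw [below, ← Finset.card_map σ.toEmbedding]
    congr 1
    ext z
    obtain ⟨z, rfl⟩ := σ.surjective z
    simp only [Finset.mem_map_equiv, Equiv.symm_apply_apply, Finset.mem_filter]
    rw [hσ, glue_mem_iff]
  -- Pigeonhole: two subsets of `A` whose sizes add up to more than `A.card` must meet.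
  have hne : (A.filter (· < x) ∩ A.filter (fun z => σ z < σ x)).Nonempty := by
    rw [← Finset.card_pos]
    have h3 := Finset.card_union_add_card_inter (A.filter (· < x)) (A.filter (fun z => σ z < σ x))
    have h4 : (A.filter (· < x) ∪ A.filter (fun z => σ z < σ x)).card ≤ A.card :=
      Finset.card_le_card (Finset.union_subset (Finset.filter_subset _ _)
        (Finset.filter_subset _ _))
    rw [hcard] at h3
    unfold below at *
    omega
  obtain ⟨y, hy⟩ := hne
  rw [Finset.mem_inter, Finset.mem_filter, Finset.mem_filter] at hy
  exact ⟨y, hy.1.1, hy.1.2, hy.2.2⟩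

/-- The decreasing bijection sends rank `t` in `A` to rank `K - 1 - t = t'` in `B`. -/
theorem glue_apply_marked {N K n s m t t' : ℕ} {p p' : Fin N} {A B : Finset (Fin N)}
    (hK : K = t + t' + 1)
    (hA : A ∈ profileSets N p t K s n m) (hB : B ∈ profileSets N p' t' K s n m)
    (hcA : A.card = K) (hcA' : Aᶜ.card = n) (hcB : B.card = K) (hcB' : Bᶜ.card = n)
    (ω : Equiv.Perm (Fin n)) : glue hcA hcA' hcB hcB' ω p = p' := by
  obtain ⟨-, -, hA2, hA3, -⟩ := Finset.mem_filter.1 hA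
  obtain ⟨-, -, hB2, hB3, -⟩ := Finset.mem_filter.1 hB
  obtain ⟨i, rfl⟩ := exists_orderEmbOfFin_eq hcA hA2
  obtain ⟨j, rfl⟩ := exists_orderEmbOfFin_eq hcB hB2
  rw [below_orderEmbOfFin] at hA3 hB3
  rw [glue_apply_mem]
  congr 1
  ext
  rw [Fin.val_rev]
  omega

/-- The lower bound for the number of avoiders through a given point. -/
theorem card_profileSets_mul_le {N K n s m t t' r : ℕ} {p p' : Fin N} {ε : ℝ}
    (τ : Equiv.Perm (Fin r))
    (hKN : N = K + n) (hK : K = m + s + 1) (hK' : K = t + t' + 1) (hm : 0 < m)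
    (hs : (n : ℝ) + 2 * m + m * (n * ε) ≤ n * s) :
    (profileSets N p t K s n m).card * (profileSets N p' t' K s n m).card
        * (nearAvoiders n (n * ε) τ).ncard
      ≤ (avoidersThrough N (p + 1) (p' + 1) (oneOslash τ)).ncard := by
  rw [ncard_eq_sum_minClass (avoidersThrough _ _ _ _), ← Finset.card_product,
    ← smul_eq_mul, ← Finset.sum_const]
  refine (Finset.sum_le_sum fun AB hAB => ?_).trans
    (Finset.sum_le_sum_of_subset (Finset.subset_univ _))
  obtain ⟨A, B⟩ := AB
  obtain ⟨hA, hB⟩ := Finset.mem_product.1 hAB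
  have hcA : A.card = K := (Finset.mem_filter.1 hA).2.1
  have hcB : B.card = K := (Finset.mem_filter.1 hB).2.1
  have hcA' : Aᶜ.card = n := by rw [card_compl_fin]; omega
  have hcB' : Bᶜ.card = n := by rw [card_compl_fin]; omega
  rw [← Set.ncard_image_of_injective _ (glue_injective hcA hcA' hcB hcB')]
  refine Set.ncard_le_ncard ?_ (Set.toFinite _)
  rintro _ ⟨ω, ⟨hω1, hω2⟩, rfl⟩
  have hmin := lrMin_glue hcA hcA' hcB hcB' ω
    (glue_dominates hK hm hs hA hB hcA hcA' hcB hcB' hω2)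
  exact ⟨⟨glue_avoids hcA hcA' hcB hcB' ω hmin hω1, p, rfl, by
    rw [glue_apply_marked hK' hA hB hcA hcA' hcB hcB' ω]⟩, hmin, map_glue hcA hcA' hcB hcB' ω⟩

end profile

/-! ### Upper bound by exponential weights -/

section upper

/-- A weight that is `p` before `i`, `1` at `i` and `p'` after `i`. -/
noncomputable def sideWeight {N : ℕ} (p p' : ℝ) (i x : Fin N) : ℝ :=
  if x < i then p else if x = i then 1 else p'

theorem prod_one_add_sideWeight {N : ℕ} (p p' : ℝ) (i : Fin N) :
    ∏ x, (1 + sideWeight p p' i x) = 2 * ((1 + p) ^ (i : ℕ) * (1 + p') ^ (N - 1 - i)) := by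
  have hc : (Finset.Iio i)ᶜ = Finset.Ici i := by ext; simp
  rw [← Finset.prod_mul_prod_compl (Finset.Iio i), hc, ← Finset.mul_prod_Ioi_eq_prod_Ici]
  have h1 : ∏ x ∈ Finset.Iio i, (1 + sideWeight p p' i x) = (1 + p) ^ (i : ℕ) := by
    rw [Finset.prod_congr rfl (g := fun _ => 1 + p)]
    · simp
    · intro x hx
      rw [sideWeight, if_pos (Finset.mem_Iio.1 hx)]
  have h2 : ∏ x ∈ Finset.Ioi i, (1 + sideWeight p p' i x) = (1 + p') ^ (N - 1 - i) := by
    rw [Finset.prod_congr rfl (g := fun _ => 1 + p')]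
    · simp
    · intro x hx
      have := Finset.mem_Ioi.1 hx
      rw [sideWeight, if_neg this.not_gt, if_neg this.ne']
  rw [h1, h2]
  simp only [sideWeight, lt_irrefl, if_false, if_true]
  ring

theorem sum_prod_sideWeight {N : ℕ} (p p' : ℝ) (i : Fin N) :
    ∑ A : Finset (Fin N), ∏ x ∈ A, sideWeight p p' i x
      = 2 * ((1 + p) ^ (i : ℕ) * (1 + p') ^ (N - 1 - i)) := by
  rw [← prod_one_add_sideWeight, Finset.prod_one_add, Finset.powerset_univ]

theorem sideWeight_pos {N : ℕ} {p p' : ℝ} (hp : 0 < p) (hp' : 0 < p') (i x : Fin N) :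
    0 < sideWeight p p' i x := by
  unfold sideWeight
  split_ifs <;> positivity

variable {m : ℕ} {τ : Equiv.Perm (Fin m)} {K d p q p' q' : ℝ}

/-- A Chernoff-type bound. Minima to the left of `i` have values above `j` and get weight `p * q`;
those to the right have values below `j` and get `p' * q'`. Both weights are at least `1 / d`, so
they pay for the `A.card` entries missing from `ω`, and the sum of weights over all `(A, B)` factors
into products. -/
theorem ncard_avoiders_lrMin_le (i₀ : Fin m)
    (hi₀ : ∀ i, i₀ ≤ i) (hτ₀ : ∀ i, τ i₀ ≤ τ i) (hd : 1 ≤ d) (hK : 0 ≤ K)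
    (hcard : ∀ n, ((avoiders n τ).ncard : ℝ) ≤ K * d ^ n)
    (hp : 0 < p) (hq : 0 < q) (hp' : 0 < p') (hq' : 0 < q')
    (hpq : 1 ≤ d * (p * q)) (hpq' : 1 ≤ d * (p' * q')) {N : ℕ} (i j : Fin N) :
    (({σ | σ ∈ avoiders N (oneOslash τ) ∧ i ∈ lrMin σ ∧ σ i = j} :
        Set (Equiv.Perm (Fin N))).ncard : ℝ)
      ≤ K * d ^ N * (2 * ((1 + p) ^ (i : ℕ) * (1 + p') ^ (N - 1 - i)))
        * (2 * ((1 + q') ^ (j : ℕ) * (1 + q) ^ (N - 1 - j))) := by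
  rw [ncard_eq_sum_minClass, ← sum_prod_sideWeight p p' i, ← sum_prod_sideWeight q' q j]
  rw [mul_assoc, Finset.sum_mul_sum, ← Finset.sum_product', Finset.mul_sum, Finset.univ_product_univ]
  push_cast
  refine Finset.sum_le_sum fun AB _ => ?_
  obtain ⟨A, B⟩ := AB
  have hd0 : 0 < d := by linarith
  rcases Set.eq_empty_or_nonempty ({σ | σ ∈ avoiders N (oneOslash τ) ∧ i ∈ lrMin σ ∧ σ i = j}
    ∩ minClass A B) with h | ⟨σ, ⟨hσ, hi, hj⟩, hA, hB⟩
  · rw [h]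
    have h1 := Finset.prod_nonneg (s := A) (fun x _ => (sideWeight_pos hp hp' i x).le)
    have h2 := Finset.prod_nonneg (s := B) (fun x _ => (sideWeight_pos hq' hq j x).le)
    simp only [Set.ncard_empty, Nat.cast_zero]
    positivity
  -- Each minimum contributes a factor at least one: `d * (p * q)`, `d` or `d * (p' * q')`,
  -- according to its side of `i`.
  · have hone : 1 ≤ d ^ A.card
        * ((∏ x ∈ A, sideWeight p p' i x) * ∏ x ∈ B, sideWeight q' q j x) := by
      rw [← hB, Finset.prod_map, ← Finset.prod_const, ← Finset.prod_mul_distrib,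
        ← Finset.prod_mul_distrib]
      rw [← Finset.prod_const_one (s := A)]
      refine Finset.prod_le_prod (fun _ _ => zero_le_one) fun x hx => ?_
      simp only [Equiv.toEmbedding_apply]
      rcases lt_trichotomy x i with h | rfl | h
      · have h1 := mem_lrMin.1 hi x h
        rw [hj] at h1
        rw [sideWeight, sideWeight, if_pos h, if_neg h1.not_gt, if_neg h1.ne']
        exact hpq
      · rw [hj]
        simpa [sideWeight] using hd
      · rw [← hA] at hx
        have h1 := mem_lrMin.1 hx i h
        rw [hj] at h1
        rw [sideWeight, sideWeight, if_neg h.not_gt, if_neg h.ne', if_pos h1]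
        exact hpq'
    have hAN : A.card ≤ N := by simpa using Finset.card_le_univ A
    have hsub : ((({σ | σ ∈ avoiders N (oneOslash τ) ∧ i ∈ lrMin σ ∧ σ i = j}
        ∩ minClass A B).ncard : ℕ) : ℝ) ≤ K * d ^ (N - A.card) := by
      refine le_trans ?_ (hcard (N - A.card))
      have hss : {σ | σ ∈ avoiders N (oneOslash τ) ∧ i ∈ lrMin σ ∧ σ i = j} ∩ minClass A B
          ⊆ avoiders N (oneOslash τ) ∩ minClass A B := fun σ h => ⟨h.1.1, h.2⟩
      exact_mod_cast (Set.ncard_le_ncard hss (Set.toFinite _)).trans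
        (ncard_avoiders_inter_minClass_le i₀ hi₀ hτ₀ A B)
    refine hsub.trans ?_
    have hdN : d ^ N = d ^ (N - A.card) * d ^ A.card := by rw [← pow_add]; congr 1; omega
    rw [hdN, mul_assoc, mul_assoc]
    refine mul_le_mul_of_nonneg_left ?_ hK
    exact le_mul_of_one_le_right (by positivity) hone

theorem pow_mul_pow_mono {x y : ℝ} (hy : 1 ≤ y) (hxy : y ≤ x) {i j M : ℕ} (hij : i ≤ j)
    (hj : j ≤ M) : x ^ i * y ^ (M - i) ≤ x ^ j * y ^ (M - j) := by
  obtain ⟨e, rfl⟩ := Nat.exists_eq_add_of_le hij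
  rw [show M - i = (M - (i + e)) + e by omega, pow_add, pow_add]
  have : y ^ e ≤ x ^ e := by gcongr
  have h1 : 0 ≤ x ^ i := by have : 0 ≤ x := by linarith
                            positivity
  have h2 : 0 ≤ y ^ (M - (i + e)) := by positivity
  calc x ^ i * (y ^ (M - (i + e)) * y ^ e) ≤ x ^ i * (y ^ (M - (i + e)) * x ^ e) := by gcongr
    _ = _ := by ring

/-- The upper bound for the number of avoiders through a given point. -/
theorem ncard_avoidersThrough_le (i₀ : Fin m)
    (hi₀ : ∀ i, i₀ ≤ i) (hτ₀ : ∀ i, τ i₀ ≤ τ i) (hd : 1 ≤ d) (hK : 0 ≤ K)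
    (hcard : ∀ n, ((avoiders n τ).ncard : ℝ) ≤ K * d ^ n)
    (hp : 0 < p) (hq : 0 < q) (hp' : 0 < p') (hq' : 0 < q')
    (hpq : 1 ≤ d * (p * q)) (hpq' : 1 ≤ d * (p' * q')) (hpp : p' ≤ p) (hqq : q ≤ q')
    {N : ℕ} (I J : Fin N) :
    ((avoidersThrough N (I + 1) (J + 1) (oneOslash τ)).ncard : ℝ)
      ≤ (N : ℝ) ^ 2 * (K * d ^ N * (2 * ((1 + p) ^ (I : ℕ) * (1 + p') ^ (N - 1 - I)))
        * (2 * ((1 + q') ^ (J : ℕ) * (1 + q) ^ (N - 1 - J)))) := by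
  -- Some minimum lies weakly to the left of and below the given entry. Since `p' ≤ p` and `q ≤ q'`,
  -- the bound for that minimum is largest at `(I, J)`.
  have hsub : avoidersThrough N (I + 1) (J + 1) (oneOslash τ) ⊆
      ⋃ ij ∈ Finset.Iic I ×ˢ Finset.Iic J,
        {σ | σ ∈ avoiders N (oneOslash τ) ∧ ij.1 ∈ lrMin σ ∧ σ ij.1 = ij.2} := by
    rintro σ ⟨hσ, i, hi, hj⟩
    obtain rfl : i = I := by ext; omega
    obtain ⟨y, hy, hyi, hyj⟩ := exists_lrMin_le σ i
    simp only [Set.mem_iUnion]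
    refine ⟨(y, σ y), Finset.mem_product.2 ⟨Finset.mem_Iic.2 hyi, Finset.mem_Iic.2 ?_⟩,
      hσ, hy, rfl⟩
    rw [show J = σ i by ext; omega]
    exact hyj
  have h1 := (Set.ncard_le_ncard hsub (Set.toFinite _)).trans (Finset.set_ncard_biUnion_le _ _)
  have h2 : ((avoidersThrough N (I + 1) (J + 1) (oneOslash τ)).ncard : ℝ) ≤
      ∑ ij ∈ Finset.Iic I ×ˢ Finset.Iic J, (({σ | σ ∈ avoiders N (oneOslash τ) ∧
        ij.1 ∈ lrMin σ ∧ σ ij.1 = ij.2} : Set (Equiv.Perm (Fin N))).ncard : ℝ) := by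
    exact_mod_cast h1
  refine h2.trans ((Finset.sum_le_card_nsmul _ _ (K * d ^ N * (2 * ((1 + p) ^ (I : ℕ)
    * (1 + p') ^ (N - 1 - I))) * (2 * ((1 + q') ^ (J : ℕ) * (1 + q) ^ (N - 1 - J)))) ?_).trans ?_)
  · intro ij hij
    obtain ⟨hi, hj⟩ := Finset.mem_product.1 hij
    have hi : (ij.1 : ℕ) ≤ I := Fin.le_def.1 (Finset.mem_Iic.1 hi)
    have hj : (ij.2 : ℕ) ≤ J := Fin.le_def.1 (Finset.mem_Iic.1 hj)
    refine (ncard_avoiders_lrMin_le i₀ hi₀ hτ₀ hd hK hcard hp hq hp' hq' hpq hpq' ij.1 ij.2).trans ?_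
    have h3 := pow_mul_pow_mono (x := 1 + p) (y := 1 + p') (by linarith) (by linarith) hi
      (show (I : ℕ) ≤ N - 1 by omega)
    have h4 := pow_mul_pow_mono (x := 1 + q') (y := 1 + q) (by linarith) (by linarith) hj
      (show (J : ℕ) ≤ N - 1 by omega)
    gcongr
  · rw [nsmul_eq_mul]
    refine mul_le_mul_of_nonneg_right ?_ (by positivity)
    rw [Finset.card_product, sq]
    have := I.2
    have := J.2
    simp only [Fin.card_Iic]
    push_cast
    gcongr <;> norm_cast

end upper

/-! ### The growth rate exceeds one -/

section growth

/-- The map that exchanges `2 t` and `2 t + 1` for every `t ∈ T`. -/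
def pairSwap (n : ℕ) (T : Finset ℕ) (i : Fin (2 * n)) : Fin (2 * n) :=
  ⟨if (i : ℕ) / 2 ∈ T then 4 * ((i : ℕ) / 2) + 1 - i else i, by split_ifs <;> omega⟩

theorem pairSwap_involutive (n : ℕ) (T : Finset ℕ) : Function.Involutive (pairSwap n T) := by
  intro i
  ext
  by_cases h : (i : ℕ) / 2 ∈ T
  · have h' : (4 * ((i : ℕ) / 2) + 1 - i) / 2 = (i : ℕ) / 2 := by omega
    simp only [pairSwap, h, if_true, h']
    omega
  · simp [pairSwap, h]

theorem pairSwap_div_two (n : ℕ) (T : Finset ℕ) (i : Fin (2 * n)) :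
    (pairSwap n T i : ℕ) / 2 = (i : ℕ) / 2 := by
  unfold pairSwap
  dsimp only
  split_ifs <;> omega

/-- In the reversal of a product of swaps of `2 t` and `2 t + 1`, entries increase only within such
a pair. The first entry of `τ` lies below the next two, so a copy would need three positions in one
pair. -/
theorem two_pow_le_ncard_avoiders {k : ℕ} (hk : 3 ≤ k) (τ : Equiv.Perm (Fin k))
    (i₀ : Fin k) (hi₀ : ∀ i, i₀ ≤ i) (hτ₀ : ∀ i, τ i₀ ≤ τ i) (n : ℕ) :
    2 ^ n ≤ (avoiders (2 * n) τ).ncard := by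
  have hcard : ((Finset.range n).powerset : Set (Finset ℕ)).ncard = 2 ^ n := by
    rw [Set.ncard_coe_finset, Finset.card_powerset, Finset.card_range]
  rw [← hcard]
  refine Set.ncard_le_ncard_of_injOn
    (fun T => ((pairSwap_involutive n T).toPerm).trans Fin.revPerm) ?_ ?_ (Set.toFinite _)
  · rintro T - ⟨f, hf, hτ⟩
    have hsame : ∀ i j : Fin (2 * n), i < j → pairSwap n T j < pairSwap n T i →
        (i : ℕ) / 2 = (j : ℕ) / 2 := by
      intro i j hij hji
      have h1 := pairSwap_div_two n T i
      have h2 := pairSwap_div_two n T j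
      have h3 : (i : ℕ) < j := hij
      have h4 : (pairSwap n T j : ℕ) < pairSwap n T i := hji
      omega
    have hlow : ∀ j : Fin k, i₀ < j → (f i₀ : ℕ) / 2 = (f j : ℕ) / 2 := by
      intro j hj
      refine hsame _ _ (hf hj) ?_
      have h1 := (hτ _ _).2 (lt_of_le_of_ne (hτ₀ j) fun h => hj.ne (τ.injective h))
      simpa using h1
    have h01 : i₀ < ⟨1, by omega⟩ := by
      refine Fin.lt_def.2 (Nat.lt_succ_iff.2 ?_)
      by_contra! h
      exact absurd (hi₀ ⟨(i₀ : ℕ) - 1, by omega⟩) (by simp [Fin.le_def]; omega)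
    have h12 : (⟨1, by omega⟩ : Fin k) < ⟨2, by omega⟩ := by simp
    have h1 := hlow _ h01
    have h2 := hlow _ (h01.trans h12)
    have h3 : (f i₀ : ℕ) < f ⟨1, by omega⟩ := hf h01
    have h4 : (f ⟨1, by omega⟩ : ℕ) < f ⟨2, by omega⟩ := hf h12
    omega
  · intro T hT T' hT' h
    have hT : T ⊆ Finset.range n := Finset.mem_powerset.1 (Finset.mem_coe.1 hT)
    have hT' : T' ⊆ Finset.range n := Finset.mem_powerset.1 (Finset.mem_coe.1 hT')
    have key : ∀ t < n, t ∈ T ↔ t ∈ T' := by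
      intro t ht
      have h1 := DFunLike.congr_fun h ⟨2 * t, by omega⟩
      have h2 : pairSwap n T ⟨2 * t, by omega⟩ = pairSwap n T' ⟨2 * t, by omega⟩ := by
        simpa using h1
      have h3 := congrArg Fin.val h2
      have h4 : 2 * t / 2 = t := by omega
      simp only [pairSwap, h4] at h3
      split_ifs at h3 with h5 h6 h6
      · exact iff_of_true h5 h6
      · omega
      · omega
      · exact iff_of_false h5 h6
    ext t
    by_cases ht : t < n
    · exact key t ht
    · exact iff_of_false (fun h => ht (Finset.mem_range.1 (hT h)))
        (fun h => ht (Finset.mem_range.1 (hT' h)))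

theorem one_lt_of_tendsto {k : ℕ} (hk : 3 ≤ k) (τ : Equiv.Perm (Fin k))
    (i₀ : Fin k) (hi₀ : ∀ i, i₀ ≤ i) (hτ₀ : ∀ i, τ i₀ ≤ τ i) {c : ℝ}
    (hc : Tendsto (fun N : ℕ => ((avoiders N τ).ncard : ℝ) ^ (1 / (N : ℝ))) atTop (𝓝 c)) :
    1 < c := by
  have h2 : Tendsto (fun n : ℕ => 2 * n) atTop atTop :=
    tendsto_id.const_mul_atTop' (by norm_num)
  have h1 : (1 : ℝ) < 2 ^ (1 / 2 : ℝ) := Real.one_lt_rpow (by norm_num) (by norm_num)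
  refine h1.trans_le (ge_of_tendsto (hc.comp h2) ?_)
  filter_upwards [eventually_gt_atTop 0] with n hn
  have h3 : ((2 : ℝ) ^ n) ≤ (avoiders (2 * n) τ).ncard := by
    exact_mod_cast two_pow_le_ncard_avoiders hk τ i₀ hi₀ hτ₀ n
  have h4 : ((2 : ℝ) ^ n) ^ (1 / ((2 * n : ℕ) : ℝ)) = 2 ^ (1 / 2 : ℝ) := by
    rw [← Real.rpow_natCast, ← Real.rpow_mul (by norm_num)]
    congr 1
    push_cast
    have : (n : ℝ) ≠ 0 := by positivity
    field_simp
  rw [← h4]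
  exact Real.rpow_le_rpow (by positivity) h3 (by positivity)

/-- A sequence whose `n`-th roots tend to `c` is bounded by a multiple of `d ^ n` for `d > c`. -/
theorem exists_le_mul_pow {x : ℕ → ℕ} {c d : ℝ} (hd : 1 ≤ d) (hcd : c < d)
    (hc : Tendsto (fun N : ℕ => (x N : ℝ) ^ (1 / (N : ℝ))) atTop (𝓝 c)) :
    ∃ K : ℝ, 0 < K ∧ ∀ n, (x n : ℝ) ≤ K * d ^ n := by
  obtain ⟨n₀, hn₀⟩ := eventually_atTop.1
    ((hc.eventually (gt_mem_nhds hcd)).and (eventually_gt_atTop 0))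
  have hd0 : 0 < d := by linarith
  refine ⟨1 + ∑ i ∈ Finset.range n₀, (x i : ℝ), by positivity, fun n => ?_⟩
  have hsum : (0 : ℝ) ≤ ∑ i ∈ Finset.range n₀, (x i : ℝ) := by positivity
  have hdn : 1 ≤ d ^ n := one_le_pow₀ hd
  by_cases hn : n < n₀
  · have h1 : (x n : ℝ) ≤ ∑ i ∈ Finset.range n₀, (x i : ℝ) :=
      Finset.single_le_sum (f := fun i => (x i : ℝ)) (fun i _ => by positivity)
        (Finset.mem_range.2 hn)
    nlinarith
  · obtain ⟨h1, h2⟩ := hn₀ n (not_lt.1 hn)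
    have h3 : (x n : ℝ) ≤ d ^ n := by
      have h4 : ((x n : ℝ) ^ (1 / (n : ℝ))) ^ n ≤ d ^ n := by gcongr
      rwa [← Real.rpow_natCast, ← Real.rpow_mul (by positivity), one_div,
        inv_mul_cancel₀ (by positivity), Real.rpow_one] at h4
    nlinarith

end growth

/-! ### Entropy estimates for dense sets -/

section entropy

open Nat in
-- The Poisson weight `a ^ m / m !` is largest at `m = a`.
theorem factorial_mul_pow_le (a m : ℕ) : a ! * a ^ m ≤ m ! * a ^ a := by
  rcases le_total a m with h | h
  · calc a ! * a ^ m = (a ! * a ^ (m - a)) * a ^ a := by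
          rw [mul_assoc, ← pow_add]; congr 2; omega
      _ ≤ m ! * a ^ a := by gcongr; exact Nat.factorial_mul_pow_sub_le_factorial h
  · have h1 := Nat.factorial_mul_descFactorial (show a - m ≤ a by omega)
    rw [show a - (a - m) = m by omega] at h1
    calc a ! * a ^ m = m ! * (a.descFactorial (a - m) * a ^ m) := by rw [← h1]; ring
      _ ≤ m ! * (a ^ (a - m) * a ^ m) := by gcongr; exact Nat.descFactorial_le_pow _ _
      _ = m ! * a ^ a := by rw [← pow_add]; congr 2; omega

open Nat in
/-- The binomial distribution with mean `a` has its mode at `a`. -/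
theorem choose_mul_pow_le (a b m m' : ℕ) (h : m + m' = a + b) :
    (a + b).choose m * (a ^ m * b ^ m') ≤ (a + b).choose a * (a ^ a * b ^ b) := by
  have h1 := Nat.add_choose_mul_factorial_mul_factorial a b
  have h2 := Nat.add_choose_mul_factorial_mul_factorial m m'
  rw [← Nat.choose_symm_add] at h1 h2
  rw [h] at h2
  have ha := factorial_mul_pow_le a m
  have hb := factorial_mul_pow_le b m'
  have hpos : 0 < a ! * b ! * (m ! * m' !) := by positivity
  refine Nat.le_of_mul_le_mul_left (?_ : a ! * b ! * (m ! * m' !) * _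
    ≤ a ! * b ! * (m ! * m' !) * _) hpos
  calc a ! * b ! * (m ! * m' !) * ((a + b).choose m * (a ^ m * b ^ m'))
      = ((a + b).choose m * m ! * m' !) * ((a ! * a ^ m) * (b ! * b ^ m')) := by ring
    _ ≤ ((a + b).choose m * m ! * m' !) * ((m ! * a ^ a) * (m' ! * b ^ b)) := by gcongr
    _ = ((a + b).choose a * a ! * b !) * ((m ! * a ^ a) * (m' ! * b ^ b)) := by rw [h1, h2]
    _ = _ := by ring

theorem pow_le_choose_mul (a b : ℕ) :
    (a + b) ^ (a + b) ≤ (a + b + 1) * ((a + b).choose a * (a ^ a * b ^ b)) := by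
  rw [add_pow]
  refine (Finset.sum_le_card_nsmul _ _ _ fun m hm => ?_).trans_eq
    (by rw [Finset.card_range, smul_eq_mul])
  have hm := Finset.mem_range.1 hm
  rw [mul_comm]
  exact choose_mul_pow_le a b m _ (by omega)

/-- The exponential growth rate of `(l choose a)`. -/
noncomputable def ent (l a : ℝ) : ℝ :=
  l * Real.log l - a * Real.log a - (l - a) * Real.log (l - a)

theorem denseSets_pos {l a : ℕ} (hl : 0 < l) (ha : a ≤ l) : 0 < (denseSets l a).card := by
  have h1 := choose_le_card_denseSets hl a
  have h2 := Nat.choose_pos ha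
  exact Nat.pos_of_mul_pos_left (h2.trans_le h1)

/-- One logarithm pays for the `l + 1` terms of the binomial expansion, each at most the modal one,
and the other for the cycle lemma. -/
theorem ent_le_log_card {l a : ℕ} (hl : 0 < l) (ha : a ≤ l) :
    ent l a - 2 * Real.log (l + 1) ≤ Real.log (denseSets l a).card := by
  obtain ⟨b, rfl⟩ := Nat.exists_eq_add_of_le ha
  have hD := denseSets_pos hl ha
  have h1 : (a + b) ^ (a + b) ≤ (a + b + 1) ^ 2 * ((denseSets (a + b) a).card * (a ^ a * b ^ b)) := by
    calc (a + b) ^ (a + b) ≤ (a + b + 1) * ((a + b).choose a * (a ^ a * b ^ b)) :=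
          pow_le_choose_mul a b
      _ ≤ (a + b + 1) * (((a + b) * (denseSets (a + b) a).card) * (a ^ a * b ^ b)) := by
          gcongr; exact choose_le_card_denseSets hl a
      _ ≤ (a + b + 1) * (((a + b + 1) * (denseSets (a + b) a).card) * (a ^ a * b ^ b)) := by
          exact Nat.mul_le_mul_left _ (Nat.mul_le_mul_right _ (Nat.mul_le_mul_right _
            (Nat.le_succ _)))
      _ = _ := by ring
  have h2 : ((a : ℝ) + b) ^ (a + b) ≤ ((a : ℝ) + b + 1) ^ 2
      * ((denseSets (a + b) a).card * ((a : ℝ) ^ a * (b : ℝ) ^ b)) := by exact_mod_cast h1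
  have hab : (0 : ℝ) < (a : ℝ) + b := by exact_mod_cast hl
  have hself : ∀ x : ℕ, (0 : ℝ) < (x : ℝ) ^ x := by
    intro x
    exact_mod_cast Nat.pow_self_pos
  have h3 := Real.log_le_log (by positivity) h2
  have hD' : (0 : ℝ) < (denseSets (a + b) a).card := by exact_mod_cast hD
  rw [Real.log_mul (by positivity) (mul_pos hD' (mul_pos (hself a) (hself b))).ne',
    Real.log_mul hD'.ne' (mul_pos (hself a) (hself b)).ne',
    Real.log_mul (hself a).ne' (hself b).ne', Real.log_pow, Real.log_pow, Real.log_pow,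
    Real.log_pow] at h3
  unfold ent
  push_cast at h3 ⊢
  rw [add_sub_cancel_left]
  linarith

theorem ent_smul {t l a : ℝ} (ht : 0 < t) (hl : 0 < l) (ha : 0 ≤ a) (hal : a ≤ l) :
    ent (t * l) (t * a) = t * ent l a := by
  have key : ∀ x : ℝ, 0 ≤ x → t * x * Real.log (t * x) = t * (x * Real.log x) +
      t * x * Real.log t := by
    intro x hx
    rcases hx.eq_or_lt with rfl | hx
    · simp
    · rw [Real.log_mul ht.ne' hx.ne']
      ring
  unfold ent
  rw [← mul_sub, key l hl.le, key a ha, key (l - a) (by linarith)]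
  ring

theorem continuous_ent : Continuous (fun x : ℝ × ℝ => ent x.1 x.2) := by
  have h := Real.continuous_mul_log
  have h1 := h.comp (continuous_fst (X := ℝ) (Y := ℝ))
  have h2 := h.comp (continuous_snd (X := ℝ) (Y := ℝ))
  have h3 := h.comp ((continuous_fst (X := ℝ) (Y := ℝ)).sub continuous_snd)
  exact (h1.sub h2).sub h3

theorem tendsto_ent_div {l a : ℕ → ℕ} {L A : ℝ}
    (hl : Tendsto (fun N : ℕ => (l N : ℝ) / N) atTop (𝓝 L))
    (ha : Tendsto (fun N : ℕ => (a N : ℝ) / N) atTop (𝓝 A))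
    (hl0 : ∀ᶠ N in atTop, 0 < l N) (hal : ∀ᶠ N in atTop, a N ≤ l N) :
    Tendsto (fun N : ℕ => ent (l N) (a N) / N) atTop (𝓝 (ent L A)) := by
  have h := (continuous_ent.tendsto (L, A)).comp (hl.prodMk_nhds ha)
  refine h.congr' ?_
  filter_upwards [hl0, hal, eventually_gt_atTop 0] with N h1 h2 hN
  have hN' : (0 : ℝ) < N := by exact_mod_cast hN
  have h1' : (0 : ℝ) < l N := by exact_mod_cast h1
  have h2' : (a N : ℝ) ≤ l N := by exact_mod_cast h2
  have := ent_smul (inv_pos.2 hN') h1' (by positivity) h2'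
  simp only [Function.comp_apply]
  rw [div_eq_inv_mul, div_eq_inv_mul, div_eq_inv_mul, this]

theorem tendsto_log_succ_div : Tendsto (fun N : ℕ => Real.log ((N : ℝ) + 1) / N) atTop (𝓝 0) := by
  have h1 : Tendsto (fun N : ℕ => Real.log ((N + 1 : ℕ) : ℝ) / ((N + 1 : ℕ) : ℝ)) atTop (𝓝 0) :=
    (Real.isLittleO_log_id_atTop.tendsto_div_nhds_zero.comp tendsto_natCast_atTop_atTop).comp
      (tendsto_add_atTop_nat 1)
  have h2 : Tendsto (fun N : ℕ => (1 : ℝ) + 1 / (N : ℝ)) atTop (𝓝 (1 + 0)) :=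
    tendsto_one_div_atTop_nhds_zero_nat.const_add 1
  have h3 := h1.mul h2
  rw [zero_mul] at h3
  refine h3.congr' ?_
  filter_upwards [eventually_gt_atTop 0] with N hN
  have hN' : (0 : ℝ) < N := by exact_mod_cast hN
  push_cast
  field_simp

end entropy

/-! ### Limits of scaled natural-number sequences -/

section asymptotics

theorem tendsto_natSub_div {x y : ℕ → ℕ} {X Y : ℝ}
    (hx : Tendsto (fun N : ℕ => (x N : ℝ) / N) atTop (𝓝 X))
    (hy : Tendsto (fun N : ℕ => (y N : ℝ) / N) atTop (𝓝 Y)) (hXY : Y < X) :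
    (∀ᶠ N in atTop, y N < x N) ∧
      Tendsto (fun N : ℕ => ((x N - y N : ℕ) : ℝ) / N) atTop (𝓝 (X - Y)) := by
  have hlt : ∀ᶠ N in atTop, y N < x N := by
    filter_upwards [hy.eventually_lt hx hXY, eventually_gt_atTop 0] with N hN hN0
    exact_mod_cast (div_lt_div_iff_of_pos_right (show (0 : ℝ) < N by exact_mod_cast hN0)).1 hN
  refine ⟨hlt, (hx.sub hy).congr' ?_⟩
  filter_upwards [hlt] with N hN
  rw [Nat.cast_sub hN.le, sub_div]

theorem tendsto_natAdd_div {x y : ℕ → ℕ} {X Y : ℝ}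
    (hx : Tendsto (fun N : ℕ => (x N : ℝ) / N) atTop (𝓝 X))
    (hy : Tendsto (fun N : ℕ => (y N : ℝ) / N) atTop (𝓝 Y)) :
    Tendsto (fun N : ℕ => ((x N + y N : ℕ) : ℝ) / N) atTop (𝓝 (X + Y)) := by
  refine (hx.add hy).congr fun N => ?_
  push_cast
  rw [add_div]

end asymptotics

/-! ### The critical densities and `log G` -/

section critical

/-- The positive solution `α` of `c α ^ 2 = (u - α) (v - α)`. -/
noncomputable def crit (u v c : ℝ) : ℝ :=
  (Real.sqrt ((v - u) ^ 2 + 4 * c * u * v) - (u + v)) / (2 * (c - 1))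

theorem crit_comm (u v c : ℝ) : crit u v c = crit v u c := by
  unfold crit
  rw [show (v - u) ^ 2 + 4 * c * u * v = (u - v) ^ 2 + 4 * c * v * u by ring, add_comm u v]

variable {u v c : ℝ}

theorem crit_pos (hu : 0 < u) (hv : 0 < v) (hc : 1 < c) : 0 < crit u v c := by
  refine div_pos (sub_pos.2 (Real.lt_sqrt_of_sq_lt ?_)) (by linarith)
  have : 0 < (c - 1) * (u * v) := mul_pos (by linarith) (by positivity)
  nlinarith

theorem crit_eq (hu : 0 < u) (hv : 0 < v) (hc : 1 < c) :
    c * crit u v c ^ 2 = (u - crit u v c) * (v - crit u v c) := by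
  have hD : 0 ≤ (v - u) ^ 2 + 4 * c * u * v := by positivity
  have hs := Real.sq_sqrt hD
  have hc' : c - 1 ≠ 0 := by linarith
  unfold crit
  set r := Real.sqrt ((v - u) ^ 2 + 4 * c * u * v)
  field_simp
  linear_combination (c - 1) * hs

theorem crit_lt_left (hu : 0 < u) (hv : 0 < v) (hc : 1 < c) : crit u v c < u := by
  have h1 := crit_eq hu hv hc
  have h2 := crit_pos hu hv hc
  by_contra! h
  have h3 : 0 < (c - 1) * crit u v c ^ 2 := mul_pos (by linarith) (by positivity)
  nlinarith

theorem crit_lt_right (hu : 0 < u) (hv : 0 < v) (hc : 1 < c) : crit u v c < v := by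
  rw [crit_comm]
  exact crit_lt_left hv hu hc

theorem g_eq_rpow (hu : 0 < u) (hc : 1 < c) :
    g u v c = (2 * (u - crit u v c) / u) ^ (-u) := by
  have hc' : c - 1 ≠ 0 := by linarith
  unfold g crit
  congr 1
  field_simp
  ring

theorem g_pos (hu : 0 < u) (hv : 0 < v) (hc : 1 < c) : 0 < g u v c := by
  have h3 : 0 < u - crit u v c := sub_pos.2 (crit_lt_left hu hv hc)
  rw [g_eq_rpow hu hc]
  positivity

theorem log_g (hu : 0 < u) (hv : 0 < v) (hc : 1 < c) : Real.log (g u v c)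
    = u * (Real.log u - Real.log (u - crit u v c) - Real.log 2) := by
  have h3 : 0 < u - crit u v c := sub_pos.2 (crit_lt_left hu hv hc)
  rw [g_eq_rpow hu hc, Real.log_rpow (by positivity), Real.log_div (by positivity) hu.ne',
    Real.log_mul (by norm_num) h3.ne']
  ring

theorem log_eq_crit (hu : 0 < u) (hv : 0 < v) (hc : 1 < c) :
    Real.log c = Real.log (u - crit u v c) + Real.log (v - crit u v c)
    - 2 * Real.log (crit u v c) := by
  have h0 := crit_pos hu hv hc
  have h1 := crit_lt_left hu hv hc
  have h2 := crit_lt_right hu hv hc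
  rw [← Real.log_mul (by linarith) (by linarith), ← crit_eq hu hv hc,
    Real.log_mul (by linarith) (by positivity), Real.log_pow]
  push_cast
  ring

/-- By the critical equation `√c * crit u v c` is the geometric mean of the two outer quantities.
Applied to `(γ, 1 - δ)` and `(δ, 1 - γ)`, this turns `γ < 1 - δ` into the slope conditions of the
lower bound and the ordering of the weights in the upper bound. -/
theorem crit_sqrt (hu : 0 < u) (hv : 0 < v) (hc : 1 < c)
    (huv : u < v) : u - crit u v c < Real.sqrt c * crit u v c ∧
    Real.sqrt c * crit u v c < v - crit u v c := by
  have h0 := crit_pos hu hv hc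
  have h1 := crit_lt_left hu hv hc
  have h2 := crit_lt_right hu hv hc
  have h3 := crit_eq hu hv hc
  have h4 := Real.sq_sqrt (show 0 ≤ c by linarith)
  have h5 : (Real.sqrt c * crit u v c) ^ 2 = (u - crit u v c) * (v - crit u v c) := by
    rw [mul_pow, h4, h3]
  have h6 : 0 ≤ Real.sqrt c * crit u v c := by positivity
  constructor
  · refine lt_of_pow_lt_pow_left₀ 2 h6 ?_
    rw [h5, sq]
    exact mul_lt_mul_of_pos_left (by linarith) (by linarith)
  · refine lt_of_pow_lt_pow_left₀ 2 (by linarith) ?_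
    rw [h5, sq]
    exact mul_lt_mul_of_pos_right (by linarith) (by linarith)

theorem G_pos (hu : 0 < u) (hv : 0 < v) (hc : 1 < c) (hu1 : u < 1)
    (hv1 : v < 1) : 0 < G u v c := by
  unfold G
  have h1 : 0 < 1 - u := by linarith
  have h2 : 0 < 1 - v := by linarith
  have := g_pos hu hv hc
  have := g_pos hv hu hc
  have := g_pos h1 h2 hc
  have := g_pos h2 h1 hc
  positivity

/-- The powers of two in the four factors `g` have total exponent `-(u + v + (1 - u) + (1 - v)) =
-2` and cancel the `4`. This is the form met by the upper bound. -/
theorem log_G (hu : 0 < u) (hv : 0 < v) (hc : 1 < c) (hu1 : u < 1)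
    (hv1 : v < 1) : Real.log (G u v c) = Real.log c
    + u * (Real.log u - Real.log (u - crit u v c))
    + v * (Real.log v - Real.log (v - crit u v c))
    + (1 - u) * (Real.log (1 - u) - Real.log (1 - u - crit (1 - u) (1 - v) c))
    + (1 - v) * (Real.log (1 - v) - Real.log (1 - v - crit (1 - u) (1 - v) c)) := by
  have h1 : 0 < 1 - u := by linarith
  have h2 : 0 < 1 - v := by linarith
  have e1 := g_pos hu hv hc
  have e2 := g_pos hv hu hc
  have e3 := g_pos h1 h2 hc
  have e4 := g_pos h2 h1 hc
  have e5 : 0 < c := by linarith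
  unfold G
  rw [Real.log_mul (by positivity) e4.ne', Real.log_mul (by positivity) e3.ne',
    Real.log_mul (by positivity) e2.ne', Real.log_mul (by positivity) e1.ne',
    Real.log_mul (by norm_num) e5.ne', log_g hu hv hc, log_g hv hu hc, log_g h1 h2 hc,
    log_g h2 h1 hc, crit_comm v u, crit_comm (1 - v) (1 - u),
    show (4 : ℝ) = 2 ^ 2 by norm_num, Real.log_pow]
  push_cast
  ring

/-- The form met by the lower bound. It differs from `log_G` by the logarithms of the two critical
equations, multiplied by the critical densities. -/
theorem log_G_eq_ent (hu : 0 < u) (hv : 0 < v) (hc : 1 < c) (hu1 : u < 1)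
    (hv1 : v < 1) : Real.log (G u v c) =
    ent u (crit u v c) + ent v (crit u v c) + ent (1 - u) (crit (1 - u) (1 - v) c)
      + ent (1 - v) (crit (1 - u) (1 - v) c)
      + (1 - crit u v c - crit (1 - u) (1 - v) c) * Real.log c := by
  have h1 : 0 < 1 - u := by linarith
  have h2 : 0 < 1 - v := by linarith
  rw [log_G hu hv hc hu1 hv1]
  unfold ent
  linear_combination (crit u v c) * log_eq_crit hu hv hc
    + (crit (1 - u) (1 - v) c) * log_eq_crit h1 h2 hc

end critical

/-! ### Exponent of the lower bound -/

section lower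

theorem tendsto_log_comp_div {n : ℕ → ℕ} {c ν : ℝ} {f : ℕ → ℕ} (hc : 1 < c)
    (hf : Tendsto (fun n : ℕ => (f n : ℝ) ^ (1 / (n : ℝ))) atTop (𝓝 c)) (hν : 0 < ν)
    (hn : Tendsto (fun N : ℕ => (n N : ℝ) / N) atTop (𝓝 ν)) :
    (∀ᶠ N in atTop, 0 < f (n N)) ∧
      Tendsto (fun N : ℕ => Real.log (f (n N)) / N) atTop (𝓝 (ν * Real.log c)) := by
  have hnat : Tendsto n atTop atTop := by
    rw [← tendsto_natCast_atTop_iff (R := ℝ)]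
    refine (hn.pos_mul_atTop hν tendsto_natCast_atTop_atTop).congr' ?_
    filter_upwards [eventually_gt_atTop 0] with N hN
    have : (N : ℝ) ≠ 0 := by positivity
    field_simp
  have hpos : ∀ᶠ m in atTop, 0 < f m := by
    filter_upwards [hf.eventually (lt_mem_nhds (show (0 : ℝ) < c by linarith)),
      eventually_gt_atTop 0] with m hm hm0
    by_contra! h
    have h0 : f m = 0 := by omega
    rw [h0, Nat.cast_zero, Real.zero_rpow (by positivity)] at hm
    exact lt_irrefl _ hm
  refine ⟨hnat.eventually hpos, ?_⟩
  have h1 := (Real.continuousAt_log (show c ≠ 0 by linarith)).tendsto.comp (hf.comp hnat)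
  refine (hn.mul h1).congr' ?_
  filter_upwards [hnat.eventually hpos, hnat.eventually (eventually_gt_atTop 0)] with N h2 h3
  have h4 : (0 : ℝ) < f (n N) := by exact_mod_cast h2
  have h5 : (n N : ℝ) ≠ 0 := by positivity
  simp only [Function.comp_apply]
  rw [Real.log_rpow h4]
  field_simp

theorem sum_log_le_of_mul_le {D₁ D₂ D₃ D₄ X F : ℕ} (h₁ : 0 < D₁) (h₂ : 0 < D₂) (h₃ : 0 < D₃)
    (h₄ : 0 < D₄) (hX : 0 < X) (h : D₁ * D₂ * (D₃ * D₄) * X ≤ F) :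
    0 < F ∧ Real.log D₁ + Real.log D₂ + (Real.log D₃ + Real.log D₄) + Real.log X
      ≤ Real.log F := by
  have hpos : 0 < D₁ * D₂ * (D₃ * D₄) * X := by positivity
  refine ⟨hpos.trans_le h, ?_⟩
  have h' := Real.log_le_log (Nat.cast_pos.2 hpos) (Nat.cast_le (α := ℝ).2 h)
  push_cast at h'
  rwa [Real.log_mul (by positivity) (by positivity), Real.log_mul (by positivity) (by positivity),
    Real.log_mul (by positivity) (by positivity), Real.log_mul (by positivity) (by positivity)]
    at h'

/-- There are `s + a` minima before position `I` and `b + s` after it. As minima decrease, the value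
set has `s + b` elements below `J` and `a + s` above, so the roles of `a` and `b` are exchanged
there. -/
theorem ent_le_log_avoidersThrough {k : ℕ} (τ : Equiv.Perm (Fin k)) {η : ℝ}
    {N I J s a b l₁ l₂ l₁' l₂' n m : ℕ}
    (hl₁ : I = s + l₁ + 1) (hl₁' : J = s + l₁' + 1) (hl₂ : N = I + l₂) (hl₂' : N = J + l₂')
    (hn : n = (l₁ - a) + (l₂ - (b + s))) (hm : m = a + (b + s)) (ha0 : 0 < a)
    (en₁ : a < l₁) (en₂ : b + s < l₂) (en₁' : b < l₁') (en₂' : a + s < l₂')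
    (hab : (b + s) * (l₁ - a) ≤ a * (l₂ - (b + s)))
    (hab' : (a + s) * (l₁' - b) ≤ b * (l₂' - (a + s)))
    (hs : (n : ℝ) + 2 * m + m * (n * η) ≤ n * s)
    (hpos : 0 < (nearAvoiders n ((n : ℝ) * η) τ).ncard) :
    0 < (avoidersThrough N I J (oneOslash τ)).ncard ∧
      ent l₁ a + ent l₂ ((b + s : ℕ) : ℝ) + ent l₁' b + ent l₂' ((a + s : ℕ) : ℝ)
        - 8 * Real.log ((N : ℝ) + 1) + Real.log (nearAvoiders n ((n : ℝ) * η) τ).ncard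
      ≤ Real.log (avoidersThrough N I J (oneOslash τ)).ncard := by
  have hn' : (l₁' - b) + (l₂' - (a + s)) = n := by omega
  have hm' : b + (a + s) = m := by omega
  have c1 := card_mul_card_le_profileSets (N := N) (s := s) (l := l₁) (l₂ := l₂)
    (a := a) (b := b + s) (n₁ := l₁ - a) (n₂ := l₂ - (b + s))
    (by omega) (by omega) (by omega) (by omega) hab
    (by omega) ⟨I - 1, by omega⟩
    (show I - 1 = _ by omega)
  have c2 := card_mul_card_le_profileSets (N := N) (s := s) (l := l₁') (l₂ := l₂')
    (a := b) (b := a + s) (n₁ := l₁' - b) (n₂ := l₂' - (a + s))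
    (by omega) (by omega) (by omega) (by omega) hab'
    (by omega) ⟨J - 1, by omega⟩
    (show J - 1 = _ by omega)
  rw [← hn, ← hm] at c1
  rw [hn', hm', show s + b + 1 + (a + s) = s + a + 1 + (b + s) by omega] at c2
  have c3 := card_profileSets_mul_le (N := N) (K := s + a + 1 + (b + s)) (n := n)
    (s := s) (m := m) (t := s + a) (t' := s + b) (p := ⟨I - 1, by omega⟩)
    (p' := ⟨J - 1, by omega⟩) (ε := η) τ
    (by omega) (by omega) (by omega)
    (by omega) hs
  rw [show I - 1 + 1 = I by omega, show J - 1 + 1 = J by omega] at c3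
  have c4 := (Nat.mul_le_mul_right _ (Nat.mul_le_mul c1 c2)).trans c3
  have d1 := denseSets_pos (l := l₁) (a := a) (by omega) (by omega)
  have d2 := denseSets_pos (l := l₂) (a := b + s) (by omega) (by omega)
  have d3 := denseSets_pos (l := l₁') (a := b) (by omega) (by omega)
  have d4 := denseSets_pos (l := l₂') (a := a + s) (by omega) (by omega)
  have f1 := ent_le_log_card (l := l₁) (a := a) (by omega) (by omega)
  have f2 := ent_le_log_card (l := l₂) (a := b + s) (by omega) (by omega)
  have f3 := ent_le_log_card (l := l₁') (a := b) (by omega) (by omega)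
  have f4 := ent_le_log_card (l := l₂') (a := a + s) (by omega) (by omega)
  have hlog : ∀ l : ℕ, l ≤ N → Real.log ((l : ℝ) + 1) ≤ Real.log ((N : ℝ) + 1) := by
    intro l hl
    have : (l : ℝ) ≤ N := by exact_mod_cast hl
    exact Real.log_le_log (by positivity) (by linarith)
  have g1 := hlog (l₁) (by omega)
  have g2 := hlog (l₂) (by omega)
  have g3 := hlog (l₁') (by omega)
  have g4 := hlog (l₂') (by omega)
  obtain ⟨hF, hle⟩ := sum_log_le_of_mul_le d1 d2 d3 d4 hpos c4
  exact ⟨hF, by linarith⟩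

theorem exists_lower_bound {k : ℕ} (τ : Equiv.Perm (Fin k)) {c : ℝ} (hc : 1 < c)
    (hnear : ∀ ε : ℝ, 0 < ε →
      Tendsto (fun N : ℕ => ((nearAvoiders N ((N : ℝ) * ε) τ).ncard : ℝ) ^ (1 / (N : ℝ)))
        atTop (𝓝 c))
    {γ δ α β η : ℝ} (hα : 0 < α) (hβ : 0 < β) (hη : 0 < η)
    (h1 : α < γ - η) (h2 : β + η < 1 - γ) (h3 : β < δ - η) (h4 : α + η < 1 - δ)
    (h5 : (β + η) * (γ - η - α) < α * (1 - γ - (β + η)))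
    (h6 : (α + η) * (δ - η - β) < β * (1 - δ - (α + η)))
    {I J : ℕ → ℕ}
    (hI : ∀ N : ℕ, 1 ≤ N → 1 ≤ I N ∧ I N ≤ N) (hJ : ∀ N : ℕ, 1 ≤ N → 1 ≤ J N ∧ J N ≤ N)
    (hIlim : Tendsto (fun N : ℕ => (I N : ℝ) / (N : ℝ)) atTop (𝓝 γ))
    (hJlim : Tendsto (fun N : ℕ => (J N : ℝ) / (N : ℝ)) atTop (𝓝 δ)) :
    ∃ y : ℕ → ℝ, Tendsto y atTop (𝓝 (ent (γ - η) α + ent (1 - γ) (β + η) + ent (δ - η) β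
        + ent (1 - δ) (α + η) + (1 - α - β - 2 * η) * Real.log c)) ∧
      ∀ᶠ N in atTop, 0 < (avoidersThrough N (I N) (J N) (oneOslash τ)).ncard ∧
        y N ≤ Real.log (avoidersThrough N (I N) (J N) (oneOslash τ)).ncard / N := by
  obtain ⟨s, hsdef⟩ : ∃ s : ℕ → ℕ, ∀ N, s N = ⌈η * (N : ℝ)⌉₊ := ⟨_, fun _ => rfl⟩
  obtain ⟨a, hadef⟩ : ∃ a : ℕ → ℕ, ∀ N, a N = ⌊α * (N : ℝ)⌋₊ := ⟨_, fun _ => rfl⟩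
  obtain ⟨b, hbdef⟩ : ∃ b : ℕ → ℕ, ∀ N, b N = ⌊β * (N : ℝ)⌋₊ := ⟨_, fun _ => rfl⟩
  have ts : Tendsto (fun N : ℕ => (s N : ℝ) / N) atTop (𝓝 η) := by
    simp only [hsdef]
    exact (tendsto_nat_ceil_mul_div_atTop hη.le).comp tendsto_natCast_atTop_atTop
  have ta : Tendsto (fun N : ℕ => (a N : ℝ) / N) atTop (𝓝 α) := by
    simp only [hadef]
    exact (tendsto_nat_floor_mul_div_atTop hα.le).comp tendsto_natCast_atTop_atTop
  have tb : Tendsto (fun N : ℕ => (b N : ℝ) / N) atTop (𝓝 β) := by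
    simp only [hbdef]
    exact (tendsto_nat_floor_mul_div_atTop hβ.le).comp tendsto_natCast_atTop_atTop
  have t1 : Tendsto (fun N : ℕ => ((1 : ℕ) : ℝ) / N) atTop (𝓝 0) := by
    simpa using tendsto_one_div_atTop_nhds_zero_nat (𝕜 := ℝ)
  have tN : Tendsto (fun N : ℕ => (N : ℝ) / N) atTop (𝓝 1) := by
    refine tendsto_const_nhds.congr' ?_
    filter_upwards [eventually_gt_atTop 0] with N hN
    rw [div_self (by positivity)]
  obtain ⟨eI, tI⟩ := tendsto_natSub_div hIlim t1 (by linarith)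
  obtain ⟨el₁, tl₁⟩ := tendsto_natSub_div tI ts (by linarith)
  obtain ⟨eJ, tJ⟩ := tendsto_natSub_div hJlim t1 (by linarith)
  obtain ⟨el₁', tl₁'⟩ := tendsto_natSub_div tJ ts (by linarith)
  obtain ⟨el₂, tl₂⟩ := tendsto_natSub_div (x := fun N => N) tN hIlim (by linarith)
  obtain ⟨el₂', tl₂'⟩ := tendsto_natSub_div (x := fun N => N) tN hJlim (by linarith)
  rw [sub_zero] at tl₁ tl₁'
  have tbs := tendsto_natAdd_div tb ts
  have tas := tendsto_natAdd_div ta ts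
  obtain ⟨en₁, tn₁⟩ := tendsto_natSub_div tl₁ ta (by linarith)
  obtain ⟨en₂, tn₂⟩ := tendsto_natSub_div tl₂ tbs (by linarith)
  obtain ⟨en₁', tn₁'⟩ := tendsto_natSub_div tl₁' tb (by linarith)
  obtain ⟨en₂', tn₂'⟩ := tendsto_natSub_div tl₂' tas (by linarith)
  have tn := tendsto_natAdd_div tn₁ tn₂
  have tm := tendsto_natAdd_div ta tbs
  obtain ⟨l₁, hl₁⟩ : ∃ l : ℕ → ℕ, ∀ N, l N = I N - 1 - s N := ⟨_, fun _ => rfl⟩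
  obtain ⟨l₂, hl₂⟩ : ∃ l : ℕ → ℕ, ∀ N, l N = N - I N := ⟨_, fun _ => rfl⟩
  obtain ⟨l₁', hl₁'⟩ : ∃ l : ℕ → ℕ, ∀ N, l N = J N - 1 - s N := ⟨_, fun _ => rfl⟩
  obtain ⟨l₂', hl₂'⟩ : ∃ l : ℕ → ℕ, ∀ N, l N = N - J N := ⟨_, fun _ => rfl⟩
  simp only [← hl₁, ← hl₂, ← hl₁', ← hl₂'] at tl₁ tl₂ tl₁' tl₂' en₁ en₂ en₁' en₂'
  simp only [← hl₁, ← hl₂, ← hl₁', ← hl₂'] at tn₁ tn₂ tn₁' tn₂' tn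
  obtain ⟨n, hn⟩ : ∃ n : ℕ → ℕ, ∀ N, n N = (l₁ N - a N) + (l₂ N - (b N + s N)) :=
    ⟨_, fun _ => rfl⟩
  obtain ⟨m, hm⟩ : ∃ m : ℕ → ℕ, ∀ N, m N = a N + (b N + s N) := ⟨_, fun _ => rfl⟩
  simp only [← hn] at tn
  simp only [← hm] at tm
  obtain ⟨epos, tnear⟩ := tendsto_log_comp_div hc (hnear η hη)
    (show 0 < (γ - η - α) + (1 - γ - (β + η)) by linarith) tn
  have t₁ := tendsto_ent_div tl₁ ta (by filter_upwards [en₁] with N hN; exact hN.pos)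
    (by filter_upwards [en₁] with N hN; exact hN.le)
  have t₂ := tendsto_ent_div tl₂ tbs (by filter_upwards [en₂] with N hN; exact hN.pos)
    (by filter_upwards [en₂] with N hN; exact hN.le)
  have t₁' := tendsto_ent_div tl₁' tb (by filter_upwards [en₁'] with N hN; exact hN.pos)
    (by filter_upwards [en₁'] with N hN; exact hN.le)
  have t₂' := tendsto_ent_div tl₂' tas (by filter_upwards [en₂'] with N hN; exact hN.pos)
    (by filter_upwards [en₂'] with N hN; exact hN.le)
  refine ⟨fun N => (ent (l₁ N) (a N) + ent (l₂ N) ((b N + s N : ℕ) : ℝ) + ent (l₁' N) (b N)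
        + ent (l₂' N) ((a N + s N : ℕ) : ℝ) - 8 * Real.log ((N : ℝ) + 1)
        + Real.log (nearAvoiders (n N) ((n N : ℝ) * η) τ).ncard) / N, ?_, ?_⟩
  rotate_left
  · have e1 := (tbs.mul tn₁).eventually_lt (ta.mul tn₂) h5
    have e2 := (tas.mul tn₁').eventually_lt (tb.mul tn₂') h6
    have hν : 0 < (γ - η - α) + (1 - γ - (β + η)) := by linarith
    -- This is the margin condition `hs` divided by `N²`. The terms `n + 2 m` vanish in the limit,
    -- and what remains amounts to `α + β + η < 1`.
    have e3 : ∀ᶠ N : ℕ in atTop, ((n N : ℝ) / N) * (((1 : ℕ) : ℝ) / N)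
        + 2 * ((m N : ℝ) / N) * (((1 : ℕ) : ℝ) / N) + (m N : ℝ) / N * ((n N : ℝ) / N * η)
          < (n N : ℝ) / N * ((s N : ℝ) / N) := by
      refine (((tn.mul t1).add ((tm.const_mul 2).mul t1)).add
        (tm.mul (tn.mul_const η))).eventually_lt (tn.mul ts) ?_
      have : (α + (β + η)) * (((γ - η - α) + (1 - γ - (β + η))) * η)
          < 1 * (((γ - η - α) + (1 - γ - (β + η))) * η) := by
        apply mul_lt_mul_of_pos_right _ (by positivity)
        linarith
      linarith
    have ema := ta.eventually (lt_mem_nhds hα)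
    filter_upwards [eI, eJ, el₁, el₁', el₂, el₂', en₁, en₂, en₁', en₂', e1, e2, e3, ema, epos,
      eventually_ge_atTop 1] with N eI eJ el₁ el₁' el₂ el₂' en₁ en₂ en₁' en₂' e1 e2 e3 ema epos hN
    have hN0 : (0 : ℝ) < N := by exact_mod_cast hN
    obtain ⟨hI1, hIN⟩ := hI N hN
    obtain ⟨hJ1, hJN⟩ := hJ N hN
    have hab : (b N + s N) * (l₁ N - a N) ≤ a N * (l₂ N - (b N + s N)) := by
      rw [div_mul_div_comm, div_mul_div_comm, div_lt_div_iff_of_pos_right (by positivity)] at e1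
      exact_mod_cast e1.le
    have hab' : (a N + s N) * (l₁' N - b N) ≤ b N * (l₂' N - (a N + s N)) := by
      rw [div_mul_div_comm, div_mul_div_comm, div_lt_div_iff_of_pos_right (by positivity)] at e2
      exact_mod_cast e2.le
    have ha0 : 0 < a N := by
      rcases Nat.eq_zero_or_pos (a N) with h | h
      · rw [h] at ema; simp at ema
      · exact h
    have hs : (n N : ℝ) + 2 * m N + m N * (n N * η) ≤ n N * s N := by
      have h := mul_le_mul_of_nonneg_right e3.le (show (0 : ℝ) ≤ N * N by positivity)
      push_cast at h
      field_simp at h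
      linarith
    obtain ⟨hF, hle⟩ := ent_le_log_avoidersThrough τ (N := N) (I := I N) (J := J N)
      (by rw [hl₁ N]; omega) (by rw [hl₁' N]; omega) (by rw [hl₂ N]; omega)
      (by rw [hl₂' N]; omega) (hn N) (hm N) ha0 en₁ en₂ en₁' en₂' hab hab' hs epos
    exact ⟨hF, div_le_div_of_nonneg_right hle hN0.le⟩
  · have t := ((((t₁.add t₂).add t₁').add t₂').sub (tendsto_log_succ_div.const_mul 8)).add tnear
    refine (t.congr fun N => ?_).trans (le_of_eq ?_)
    · rw [add_div, sub_div, add_div, add_div, add_div, mul_div_assoc]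
    · congr 1
      ring

end lower

/-! ### Exponent of the upper bound -/

section upperLimit

theorem exists_upper_bound {k : ℕ} (τ : Equiv.Perm (Fin k)) (i₀ : Fin k) (hi₀ : ∀ i, i₀ ≤ i)
    (hτ₀ : ∀ i, τ i₀ ≤ τ i) {c d : ℝ} (hd : 1 ≤ d) (hcd : c < d)
    (hc : Tendsto (fun N : ℕ => ((avoiders N τ).ncard : ℝ) ^ (1 / (N : ℝ))) atTop (𝓝 c))
    {γ δ p q p' q' : ℝ} (hp : 0 < p) (hq : 0 < q) (hp' : 0 < p') (hq' : 0 < q')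
    (hpq : 1 ≤ d * (p * q)) (hpq' : 1 ≤ d * (p' * q')) (hpp : p' ≤ p) (hqq : q ≤ q')
    {I J : ℕ → ℕ}
    (hI : ∀ N : ℕ, 1 ≤ N → 1 ≤ I N ∧ I N ≤ N) (hJ : ∀ N : ℕ, 1 ≤ N → 1 ≤ J N ∧ J N ≤ N)
    (hIlim : Tendsto (fun N : ℕ => (I N : ℝ) / (N : ℝ)) atTop (𝓝 γ))
    (hJlim : Tendsto (fun N : ℕ => (J N : ℝ) / (N : ℝ)) atTop (𝓝 δ)) :
    ∃ y : ℕ → ℝ, Tendsto y atTop (𝓝 (Real.log d + γ * Real.log (1 + p)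
        + (1 - γ) * Real.log (1 + p') + δ * Real.log (1 + q') + (1 - δ) * Real.log (1 + q))) ∧
      ∀ᶠ N in atTop, ((avoidersThrough N (I N) (J N) (oneOslash τ)).ncard : ℝ)
        ≤ Real.exp (y N * N) := by
  obtain ⟨K, hK, hcard⟩ := exists_le_mul_pow hd hcd hc
  have hd0 : 0 < d := by linarith
  refine ⟨fun N => 2 * (Real.log ((N : ℝ) + 1) / N) + Real.log (4 * K) / N + Real.log d
    + (I N : ℝ) / N * Real.log (1 + p) + (1 - (I N : ℝ) / N) * Real.log (1 + p')
    + (J N : ℝ) / N * Real.log (1 + q') + (1 - (J N : ℝ) / N) * Real.log (1 + q), ?_, ?_⟩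
  · have h0 : Tendsto (fun N : ℕ => Real.log (4 * K) / (N : ℝ)) atTop (𝓝 0) :=
      tendsto_const_div_atTop_nhds_zero_nat _
    have h := ((((((tendsto_log_succ_div.const_mul 2).add h0).add_const (Real.log d)).add
      (hIlim.mul_const (Real.log (1 + p)))).add
      ((hIlim.const_sub 1).mul_const (Real.log (1 + p')))).add
      (hJlim.mul_const (Real.log (1 + q')))).add
      ((hJlim.const_sub 1).mul_const (Real.log (1 + q)))
    simpa only [mul_zero, zero_add] using h
  · filter_upwards [eventually_ge_atTop 1] with N hN
    obtain ⟨hI1, hIN⟩ := hI N hN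
    obtain ⟨hJ1, hJN⟩ := hJ N hN
    have hN0 : (0 : ℝ) < N := by exact_mod_cast hN
    have h := ncard_avoidersThrough_le i₀ hi₀ hτ₀ hd hK.le hcard hp hq hp' hq' hpq hpq' hpp hqq
      (N := N) ⟨I N - 1, by omega⟩ ⟨J N - 1, by omega⟩
    dsimp only at h
    rw [show I N - 1 + 1 = I N by omega, show J N - 1 + 1 = J N by omega,
      show N - 1 - (I N - 1) = N - I N by omega, show N - 1 - (J N - 1) = N - J N by omega] at h
    have hexp : ∀ (x : ℝ) (j : ℕ), 0 < x → Real.exp (j * Real.log x) = x ^ j := by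
      intro x j hx
      rw [Real.exp_nat_mul, Real.exp_log hx]
    have hy : (2 * (Real.log ((N : ℝ) + 1) / N) + Real.log (4 * K) / N + Real.log d
        + (I N : ℝ) / N * Real.log (1 + p) + (1 - (I N : ℝ) / N) * Real.log (1 + p')
        + (J N : ℝ) / N * Real.log (1 + q') + (1 - (J N : ℝ) / N) * Real.log (1 + q)) * N
        = (2 : ℕ) * Real.log ((N : ℝ) + 1) + Real.log (4 * K) + N * Real.log d
        + I N * Real.log (1 + p) + (N - I N : ℕ) * Real.log (1 + p')
        + J N * Real.log (1 + q') + (N - J N : ℕ) * Real.log (1 + q) := by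
      rw [Nat.cast_sub hIN, Nat.cast_sub hJN]
      field_simp
      push_cast
      ring
    rw [hy, Real.exp_add, Real.exp_add, Real.exp_add, Real.exp_add, Real.exp_add, Real.exp_add,
      hexp _ _ (by positivity), hexp _ _ (by positivity), hexp _ _ (by positivity),
      hexp _ _ (by positivity), hexp _ _ (by positivity), hexp _ _ (by positivity),
      Real.exp_log (by positivity)]
    refine h.trans ?_
    have e1 : (1 + p) ^ (I N - 1) ≤ (1 + p) ^ I N := pow_le_pow_right₀ (by linarith) (by omega)
    have e2 : (1 + q') ^ (J N - 1) ≤ (1 + q') ^ J N := pow_le_pow_right₀ (by linarith) (by omega)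
    have e3 : (N : ℝ) ^ 2 ≤ ((N : ℝ) + 1) ^ 2 := by gcongr; linarith
    calc (N : ℝ) ^ 2 * (K * d ^ N * (2 * ((1 + p) ^ (I N - 1) * (1 + p') ^ (N - I N)))
          * (2 * ((1 + q') ^ (J N - 1) * (1 + q) ^ (N - J N))))
        ≤ ((N : ℝ) + 1) ^ 2 * (K * d ^ N * (2 * ((1 + p) ^ I N * (1 + p') ^ (N - I N)))
          * (2 * ((1 + q') ^ J N * (1 + q) ^ (N - J N)))) := by gcongr
      _ = _ := by ring

end upperLimit

/-- With margin `2 N` the antidiagonal constraint is vacuous, so the hypothesis on near-avoiders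
also gives convergence for all avoiders. -/
theorem nearAvoiders_two_mul (N : ℕ) {k : ℕ} (τ : Equiv.Perm (Fin k)) :
    nearAvoiders N ((N : ℝ) * 2) τ = avoiders N τ := by
  ext σ
  refine ⟨fun h => h.1, fun h => ⟨h, fun i => ?_⟩⟩
  have h1 : (0 : ℝ) ≤ (i : ℕ) := by positivity
  have h2 : (0 : ℝ) ≤ (σ i : ℕ) := by positivity
  have h3 : (0 : ℝ) ≤ N := by positivity
  linarith

/-! ### Matching the two exponents -/

section main

variable {k : ℕ} {τ : Equiv.Perm (Fin k)} {c γ δ : ℝ}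

theorem eventually_lt_rpow (hc : 1 < c)
    (hnear : ∀ ε : ℝ, 0 < ε →
      Tendsto (fun N : ℕ => ((nearAvoiders N ((N : ℝ) * ε) τ).ncard : ℝ) ^ (1 / (N : ℝ)))
        atTop (𝓝 c))
    (hγ : 0 < γ) (hδ : 0 < δ) (hγδ : γ < 1 - δ)
    {I J : ℕ → ℕ}
    (hI : ∀ N : ℕ, 1 ≤ N → 1 ≤ I N ∧ I N ≤ N) (hJ : ∀ N : ℕ, 1 ≤ N → 1 ≤ J N ∧ J N ≤ N)
    (hIlim : Tendsto (fun N : ℕ => (I N : ℝ) / (N : ℝ)) atTop (𝓝 γ))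
    (hJlim : Tendsto (fun N : ℕ => (J N : ℝ) / (N : ℝ)) atTop (𝓝 δ))
    {x : ℝ} (hx : x < G γ (1 - δ) c) :
    ∀ᶠ N : ℕ in atTop, x < ((avoidersThrough N (I N) (J N) (oneOslash τ)).ncard : ℝ)
      ^ (1 / (N : ℝ)) := by
  have hv : 0 < 1 - δ := by linarith
  have hu' : 0 < 1 - γ := by linarith
  set α := crit γ (1 - δ) c with hαdef
  set β := crit (1 - γ) δ c with hβdef
  have hα : 0 < α := crit_pos hγ hv hc
  have hβ : 0 < β := crit_pos hu' hδ hc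
  have hα₁ : α < γ := crit_lt_left hγ hv hc
  have hα₂ : α < 1 - δ := crit_lt_right hγ hv hc
  have hβ₁ : β < 1 - γ := crit_lt_left hu' hδ hc
  have hβ₂ : β < δ := crit_lt_right hu' hδ hc
  obtain ⟨s₁, s₂⟩ := crit_sqrt hγ hv hc hγδ
  obtain ⟨s₃, s₄⟩ := crit_sqrt hδ hu' hc (by linarith)
  rw [crit_comm] at s₃ s₄
  rw [← hαdef] at s₁ s₂
  rw [← hβdef] at s₃ s₄
  -- The lower-bound exponent with margin `η`. It equals `log G` at `η = 0`, where the side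
  -- conditions are strict, so by continuity some small `η > 0` works.
  set Λ : ℝ → ℝ := fun η => ent (γ - η) α + ent (1 - γ) (β + η) + ent (δ - η) β
        + ent (1 - δ) (α + η) + (1 - α - β - 2 * η) * Real.log c with hΛ
  have hΛ0 : Λ 0 = Real.log (G γ (1 - δ) c) := by
    rw [log_G_eq_ent hγ hv hc (by linarith) (by linarith), sub_sub_cancel, ← hαdef, ← hβdef]
    simp only [hΛ, sub_zero, add_zero, mul_zero]
    ring
  have hΛc : Continuous Λ := by
    have hent : ∀ f h : ℝ → ℝ, Continuous f → Continuous h →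
        Continuous (fun η => ent (f η) (h η)) := fun f h hf hh =>
      continuous_ent.comp (hf.prodMk hh)
    exact ((((hent _ _ (by fun_prop) (by fun_prop)).add
      (hent _ _ (by fun_prop) (by fun_prop))).add
      (hent _ _ (by fun_prop) (by fun_prop))).add
      (hent _ _ (by fun_prop) (by fun_prop))).add (by fun_prop)
  have hG := G_pos hγ hv hc (by linarith) (by linarith)
  have hxΛ : x < Real.exp (Λ 0) := by rwa [hΛ0, Real.exp_log hG]
  have cont : ∀ f h : ℝ → ℝ, Continuous f → Continuous h → f 0 < h 0 →
      ∀ᶠ η in 𝓝[>] (0 : ℝ), f η < h η := fun f h hf hh h0 =>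
    ((hf.tendsto 0).eventually_lt (hh.tendsto 0) h0).filter_mono nhdsWithin_le_nhds
  have ev := (((((((cont (fun _ => x) (fun η => Real.exp (Λ η)) (by fun_prop) (by fun_prop)
    hxΛ).and
    (cont (fun _ => α) (fun η => γ - η) (by fun_prop) (by fun_prop) (by simpa using hα₁))).and
    (cont (fun η => β + η) (fun _ => 1 - γ) (by fun_prop) (by fun_prop) (by simpa using hβ₁))).and
    (cont (fun _ => β) (fun η => δ - η) (by fun_prop) (by fun_prop) (by simpa using hβ₂))).and
    (cont (fun η => α + η) (fun _ => 1 - δ) (by fun_prop) (by fun_prop) (by simpa using hα₂))).and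
    (cont (fun η => (β + η) * (γ - η - α)) (fun η => α * (1 - γ - (β + η))) (by fun_prop)
      (by fun_prop) (by
        simp only [add_zero, sub_zero]
        calc β * (γ - α) < β * (Real.sqrt c * α) := by gcongr
          _ = α * (Real.sqrt c * β) := by ring
          _ < α * (1 - γ - β) := by gcongr))).and
    (cont (fun η => (α + η) * (δ - η - β)) (fun η => β * (1 - δ - (α + η))) (by fun_prop)
      (by fun_prop) (by
        simp only [add_zero, sub_zero]
        calc α * (δ - β) < α * (Real.sqrt c * β) := by gcongr
          _ = β * (Real.sqrt c * α) := by ring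
          _ < β * (1 - δ - α) := by gcongr))).and self_mem_nhdsWithin
  obtain ⟨η, ⟨⟨⟨⟨⟨⟨hxη, h1⟩, h2⟩, h3⟩, h4⟩, h5⟩, h6⟩, hη⟩ := ev.exists
  obtain ⟨y, hy, hlow⟩ := exists_lower_bound τ hc hnear hα hβ hη h1 h2 h3 h4 h5 h6 hI hJ hIlim hJlim
  have hexp := (Real.continuous_exp.tendsto _).comp hy
  filter_upwards [hexp.eventually (lt_mem_nhds hxη), hlow, eventually_ge_atTop 1] with N h7 h8 hN
  have hF : (0 : ℝ) < (avoidersThrough N (I N) (J N) (oneOslash τ)).ncard := by exact_mod_cast h8.1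
  refine h7.trans_le ?_
  rw [Real.rpow_def_of_pos hF, mul_one_div]
  exact Real.exp_le_exp.2 h8.2

theorem eventually_rpow_lt (hc : 1 < c) (i₀ : Fin k) (hi₀ : ∀ i, i₀ ≤ i)
    (hτ₀ : ∀ i, τ i₀ ≤ τ i)
    (hav : Tendsto (fun N : ℕ => ((avoiders N τ).ncard : ℝ) ^ (1 / (N : ℝ))) atTop (𝓝 c))
    (hγ : 0 < γ) (hδ : 0 < δ) (hγδ : γ < 1 - δ)
    {I J : ℕ → ℕ}
    (hI : ∀ N : ℕ, 1 ≤ N → 1 ≤ I N ∧ I N ≤ N) (hJ : ∀ N : ℕ, 1 ≤ N → 1 ≤ J N ∧ J N ≤ N)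
    (hIlim : Tendsto (fun N : ℕ => (I N : ℝ) / (N : ℝ)) atTop (𝓝 γ))
    (hJlim : Tendsto (fun N : ℕ => (J N : ℝ) / (N : ℝ)) atTop (𝓝 δ))
    {x : ℝ} (hx : G γ (1 - δ) c < x) :
    ∀ᶠ N : ℕ in atTop, ((avoidersThrough N (I N) (J N) (oneOslash τ)).ncard : ℝ)
      ^ (1 / (N : ℝ)) < x := by
  have hv : 0 < 1 - δ := by linarith
  have hu' : 0 < 1 - γ := by linarith
  have hG := G_pos hγ hv hc (by linarith) (by linarith)
  have hlogG := log_G hγ hv hc (by linarith) (by linarith)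
  rw [sub_sub_cancel] at hlogG
  have hα : 0 < crit γ (1 - δ) c := crit_pos hγ hv hc
  have hβ : 0 < crit (1 - γ) δ c := crit_pos hu' hδ hc
  have hα₁ : crit γ (1 - δ) c < γ := crit_lt_left hγ hv hc
  have hα₂ : crit γ (1 - δ) c < 1 - δ := crit_lt_right hγ hv hc
  have hβ₁ : crit (1 - γ) δ c < 1 - γ := crit_lt_left hu' hδ hc
  have hβ₂ : crit (1 - γ) δ c < δ := crit_lt_right hu' hδ hc
  have hαeq := crit_eq hγ hv hc
  have hβeq := crit_eq hu' hδ hc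
  obtain ⟨s₁, s₂⟩ := crit_sqrt hγ hv hc hγδ
  obtain ⟨s₃, s₄⟩ := crit_sqrt hδ hu' hc (by linarith)
  rw [crit_comm] at s₃ s₄
  set α := crit γ (1 - δ) c
  set β := crit (1 - γ) δ c
  have b₁ : 0 < γ - α := by linarith
  have b₂ : 0 < 1 - δ - α := by linarith
  have b₃ : 0 < 1 - γ - β := by linarith
  have b₄ : 0 < δ - β := by linarith
  have hlt : Real.log (G γ (1 - δ) c) < Real.log x := Real.log_lt_log hG hx
  have hx0 : 0 < x := hG.trans hx
  have hc0 : 0 < c := by linarith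
  -- The factor over `c` spends half of the logarithmic gap between `G` and `x`, so the exponent
  -- stays below `log x`.
  set d := c * Real.exp ((Real.log x - Real.log (G γ (1 - δ) c)) / 2)
  have hcd : c < d := lt_mul_of_one_lt_right hc0 (Real.one_lt_exp_iff.2 (by linarith))
  have hlogd : Real.log d = Real.log c + (Real.log x - Real.log (G γ (1 - δ) c)) / 2 := by
    rw [Real.log_mul hc0.ne' (Real.exp_pos _).ne', Real.log_exp]
  have hone : ∀ a l : ℝ, 0 < l → 0 < l - a →
      Real.log (1 + a / (l - a)) = Real.log l - Real.log (l - a) := by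
    intro a l hl hla
    rw [← Real.log_div hl.ne' hla.ne']
    congr 1
    field_simp
    ring
  have hd1 : 1 ≤ d := (hc.trans hcd).le
  -- With weights `a / (l - a)` and `a / (l' - a)`, the critical equation says exactly that `c`
  -- times their product is `1`.
  have hprod : ∀ a l l' : ℝ, 0 < a → 0 < l - a → 0 < l' - a → c * a ^ 2 = (l - a) * (l' - a) →
      1 ≤ d * (a / (l - a) * (a / (l' - a))) := by
    intro a l l' ha h1 h2 h
    have : c * (a / (l - a) * (a / (l' - a))) = 1 := by
      rw [div_mul_div_comm, ← h]
      field_simp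
    rw [← this]
    gcongr
  obtain ⟨y, hy, hup⟩ := exists_upper_bound τ i₀ hi₀ hτ₀ hd1 hcd hav
    (p := α / (γ - α)) (q := α / (1 - δ - α)) (p' := β / (1 - γ - β)) (q' := β / (δ - β))
    (by positivity) (by positivity) (by positivity) (by positivity)
    (hprod _ _ _ hα b₁ b₂ hαeq) (hprod _ _ _ hβ b₃ b₄ hβeq)
    (by
      rw [div_le_div_iff₀ b₃ b₁]
      calc β * (γ - α) ≤ β * (Real.sqrt c * α) := by gcongr
        _ = α * (Real.sqrt c * β) := by ring
        _ ≤ α * (1 - γ - β) := by gcongr)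
    (by
      rw [div_le_div_iff₀ b₂ b₄]
      calc α * (δ - β) ≤ α * (Real.sqrt c * β) := by gcongr
        _ = β * (Real.sqrt c * α) := by ring
        _ ≤ β * (1 - δ - α) := by gcongr)
    hI hJ hIlim hJlim
  rw [hone _ _ hγ b₁, hone _ _ hv b₂, hone _ _ hu' b₃, hone _ _ hδ b₄] at hy
  filter_upwards [hy.eventually_lt_const (show _ < Real.log x by rw [hlogd]; linarith), hup,
    eventually_ge_atTop 1] with N h1 h2 hN
  have hN0 : (0 : ℝ) < N := by exact_mod_cast hN
  calc ((avoidersThrough N (I N) (J N) (oneOslash τ)).ncard : ℝ) ^ (1 / (N : ℝ))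
      ≤ Real.exp (y N * N) ^ (1 / (N : ℝ)) :=
        Real.rpow_le_rpow (by positivity) h2 (by positivity)
    _ = Real.exp (y N) := by
        rw [← Real.exp_mul]
        congr 1
        field_simp
    _ < x := by rwa [← Real.lt_log_iff_exp_lt hx0]

end main

end PatternLD

theorem theorem1p3 (k : ℕ) (hk : 3 ≤ k) (τ' : Equiv.Perm (Fin k))
    (hfirst : τ' ⟨0, by omega⟩ = ⟨0, by omega⟩)
    (hτ' : ∀ ε : ℝ, 0 < ε →
      Tendsto (fun N : ℕ =>
          ((PatternLD.nearAvoiders N ((N : ℝ) * ε) τ').ncard : ℝ) ^ (1 / (N : ℝ)))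
        atTop (𝓝 (PatternLD.growthRate τ')))
    (γ δ : ℝ) (hγ : γ ∈ Set.Ioo (0 : ℝ) 1) (hδ : δ ∈ Set.Ioo (0 : ℝ) 1) (hγδ : γ < 1 - δ)
    (I J : ℕ → ℕ)
    (hI : ∀ N : ℕ, 1 ≤ N → 1 ≤ I N ∧ I N ≤ N)
    (hJ : ∀ N : ℕ, 1 ≤ N → 1 ≤ J N ∧ J N ≤ N)
    (hIlim : Tendsto (fun N : ℕ => (I N : ℝ) / (N : ℝ)) atTop (𝓝 γ))
    (hJlim : Tendsto (fun N : ℕ => (J N : ℝ) / (N : ℝ)) atTop (𝓝 δ)) :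
    Tendsto (fun N : ℕ =>
        ((PatternLD.avoidersThrough N (I N) (J N) (PatternLD.oneOslash τ')).ncard : ℝ)
          ^ (1 / (N : ℝ)))
      atTop (𝓝 (PatternLD.G γ (1 - δ) (PatternLD.growthRate τ'))) := by
  have hav := hτ' 2 two_pos
  simp only [PatternLD.nearAvoiders_two_mul] at hav
  obtain ⟨i₀, hi₀, hτ₀⟩ : ∃ i₀ : Fin k, (∀ i, i₀ ≤ i) ∧ ∀ i, τ' i₀ ≤ τ' i := by
    refine ⟨_, fun i => ?_, fun i => hfirst.le.trans ?_⟩ <;>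
    exact Fin.mk_le_of_le_val (Nat.zero_le _)
  have hc := PatternLD.one_lt_of_tendsto hk τ' i₀ hi₀ hτ₀ hav
  refine tendsto_order.2 ⟨fun x hx => ?_, fun x hx => ?_⟩
  · exact PatternLD.eventually_lt_rpow hc hτ' hγ.1 hδ.1 hγδ hI hJ hIlim hJlim hx
  · exact PatternLD.eventually_rpow_lt hc i₀ hi₀ hτ₀ hav hγ.1 hδ.1 hγδ hI hJ hIlim hJlim hx
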